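/- \textbf{Definitions.} Let $A\in\mathbb C(z)$ be a rational function, regarded as a self-map of $\mathbb{CP}^1$. If $A=U\circ V$ with $U,V$ rational functions, then $V\circ U$ is called an \emph{elementary transformation} of $A$. Write $A\sim B$ if there is a finite chain of elementary transformations between $A$ and $B$. For $j\in\mathbb C$, a rational function $\mathcal L$ is said to be \emph{of the form $\mathcal L_j$} if there exist an elliptic curve $\mathcal C$ over $\mathbb C$ with $j$-invariant $j$ and a morphism $\pi:\mathcal C\to\mathbb{CP}^1$ of degree two with $\pi(-P)=\pi(P)$ such that $\mathcal L(\pi(P))=\pi(2P)$ for all $P\in\mathcal C$ (such functions exist for every $j\in\mathbb C$). For a relation (correspondence) $R$ on $\mathbb C$, say that $y$ is an image of $x$ if $R(x,y)$ holds. The forward orbit of $x$ consists of all points reached from $x$ by finitely many (possibly zero) steps from a point to one of its images, the backward orbit of all points from which $x$ is so reached, and the full orbit of all points reached from $x$ by finitely many steps taken forward or backward. When the three coincide, they are called the orbit of $x$. Let $$\Phi_2(x,y)=-x^2y^2+x^3+y^3+2^4\cdot 3\cdot 31\,xy(x+y)+3^4\cdot 5^3\cdot 4027\,xy-2^4\cdot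 3^4\cdot 5^3(x^2+y^2)+2^8\cdot 3^7\cdot 5^6(x+y)-2^{12}\cdot 3^9\cdot 5^9$$ be the classical modular polynomial of level two, and let $\beta(z)=64\,\dfrac{(z+4)^3}{z^2}$. \textbf{Theorem.} Let $j\in\mathbb C$ and let $\mathcal L$ be any rational function of the form $\mathcal L_j$. (1) Every rational function equivalent to $\mathcal L$ is of the form $\mathcal L_{j'}$ for some $j'\in\mathbb C$. (2) For $j'\in\mathbb C$, if one function of the form $\mathcal L_{j'}$ is equivalent to $\mathcal L$, then all of them are (in this case we write $\mathcal L_{j'}\sim\mathcal L_j$), and the set $\{j'\in\mathbb C:\mathcal L_{j'}\sim\mathcal L_j\}$ is exactly the orbit of $j$ under the correspondence $\Phi_2(x,y)=0$, its forward, backward and full orbits being the same. (3) The same set is the orbit (forward, backward and full) of $j$ under the multivalued function $\beta\circ\frac1z\circ\beta^{-1}$, that is, under the correspondence for which $y\in\mathbb C$ is an image of $x\in\mathbb C$ if $\beta(z)=x$ and $\beta(1/z)=y$ for some $z\in\mathbb{CP}^1$. -/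

import Mathlib

namespace Recomposition

noncomputable section

/-- The point `a / b` of the Riemann sphere `ℂ ∪ {∞}` with homogeneous coordinates `[a : b]`
(used only for `(a, b) ≠ (0, 0)`). -/
def ratio (a b : ℂ) : OnePoint ℂ :=
  if b = 0 then OnePoint.infty else ((a / b : ℂ) : OnePoint ℂ)

/-- The self-map of the Riemann sphere given by a rational function `f = p / q` in lowest terms.
At infinity one compares the coefficients of degree `max (deg p) (deg q)`. -/
def toSphere (f : RatFunc ℂ) : OnePoint ℂ → OnePoint ℂ
  | some z => ratio (f.num.eval z) (f.denom.eval z)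
  | none =>
      ratio (f.num.coeff (max f.num.natDegree f.denom.natDegree))
        (f.denom.coeff (max f.num.natDegree f.denom.natDegree))

/-- `A = U ∘ V`, as maps of the Riemann sphere. -/
def IsComp (A U V : RatFunc ℂ) : Prop :=
  toSphere A = toSphere U ∘ toSphere V

/-- `B` is an elementary transformation of `A`: `A = U ∘ V` and `B = V ∘ U` for some rational
functions `U`, `V`. -/
def IsElementaryTransformation (A B : RatFunc ℂ) : Prop :=
  ∃ U V : RatFunc ℂ, IsComp A U V ∧ IsComp B V U

/-- `A ∼ B`: there is a finite chain of elementary transformations from `A` to `B`. -/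
def Equivalent (A B : RatFunc ℂ) : Prop :=
  Relation.ReflTransGen IsElementaryTransformation A B

/-- Homogeneous coordinates in the projective plane of a point of a Weierstrass curve. -/
def coords {W : WeierstrassCurve ℂ} : W.toAffine.Point → Fin 3 → ℂ
  | .zero => ![0, 1, 0]
  | .some x y _ => ![x, y, 1]

/-- A map from (the points of) a plane projective Weierstrass curve to the Riemann sphere is a
morphism if around every point `P` it is given by `[F : G]` for homogeneous polynomials `F`, `G`
of the same degree that do not both vanish at `P`. -/
def IsMorphism {W : WeierstrassCurve ℂ} (π : W.toAffine.Point → OnePoint ℂ) : Prop :=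
  ∀ P : W.toAffine.Point, ∃ (n : ℕ) (F G : MvPolynomial (Fin 3) ℂ),
    F.IsHomogeneous n ∧ G.IsHomogeneous n ∧
    ¬ (MvPolynomial.eval (coords P) F = 0 ∧ MvPolynomial.eval (coords P) G = 0) ∧
    ∀ Q : W.toAffine.Point,
      ¬ (MvPolynomial.eval (coords Q) F = 0 ∧ MvPolynomial.eval (coords Q) G = 0) →
      π Q = ratio (MvPolynomial.eval (coords Q) F) (MvPolynomial.eval (coords Q) G)

/-- The map has degree `d`: all fibres but finitely many consist of exactly `d` points. -/
def HasDegree {W : WeierstrassCurve ℂ} (π : W.toAffine.Point → OnePoint ℂ) (d : ℕ) : Prop :=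
  ∀ᶠ t in Filter.cofinite, (π ⁻¹' {t}).ncard = d

/-- `A` is a Lattès map `𝓛_j`: there are an elliptic curve with `j`-invariant `j` and an even
morphism `π` of degree two from it to the sphere with `A (π P) = π (2 P)` for all points `P`. -/
def IsLattes (j : ℂ) (A : RatFunc ℂ) : Prop :=
  ∃ (W : WeierstrassCurve ℂ) (_ : W.IsElliptic) (π : W.toAffine.Point → OnePoint ℂ),
    W.j = j ∧ IsMorphism π ∧ HasDegree π 2 ∧ (∀ P, π (-P) = π P) ∧
    ∀ P, toSphere A (π P) = π ((2 : ℕ) • P)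

/-- The correspondence on `ℂ` associated with the affine curve `F(x, y) = 0`: the images of `x`
are the `y` with `F(x, y) = 0`. -/
def curveCorrespondence (F : MvPolynomial (Fin 2) ℤ) (x y : ℂ) : Prop :=
  MvPolynomial.aeval ![x, y] F = 0

/-- The points reached from `x` by finitely many steps of the correspondence `R`. -/
def forwardOrbit (R : ℂ → ℂ → Prop) (x : ℂ) : Set ℂ :=
  {y | Relation.ReflTransGen R x y}

/-- The points from which `x` is reached by finitely many steps of the correspondence `R`. -/
def backwardOrbit (R : ℂ → ℂ → Prop) (x : ℂ) : Set ℂ :=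
  {y | Relation.ReflTransGen R y x}

/-- The points reached from `x` by finitely many steps, each of them forward or backward. -/
def fullOrbit (R : ℂ → ℂ → Prop) (x : ℂ) : Set ℂ :=
  {y | Relation.ReflTransGen (fun a b => R a b ∨ R b a) x y}

/-- `S` is the orbit of `x` under `R`, in the sense used for symmetric correspondences: it is the
forward, the backward and the full orbit of `x`. -/
def IsOrbit (R : ℂ → ℂ → Prop) (x : ℂ) (S : Set ℂ) : Prop :=
  S = forwardOrbit R x ∧ S = backwardOrbit R x ∧ S = fullOrbit R x

/-- The classical modular polynomial `Φ₂(x, y)`. -/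
def Phi2 : MvPolynomial (Fin 2) ℤ :=
  let x : MvPolynomial (Fin 2) ℤ := MvPolynomial.X 0
  let y : MvPolynomial (Fin 2) ℤ := MvPolynomial.X 1
  x ^ 3 + y ^ 3 - x ^ 2 * y ^ 2 + 2 ^ 4 * 3 * 31 * (x * y * (x + y))
    + 3 ^ 4 * 5 ^ 3 * 4027 * (x * y) - 2 ^ 4 * 3 ^ 4 * 5 ^ 3 * (x ^ 2 + y ^ 2)
    + 2 ^ 8 * 3 ^ 7 * 5 ^ 6 * (x + y) - 2 ^ 12 * 3 ^ 9 * 5 ^ 9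

/-- The rational function `β(z) = 64 (z + 4)³ / z²`. -/
def beta : RatFunc ℂ :=
  64 * (RatFunc.X + 4) ^ 3 / RatFunc.X ^ 2

/-- The multivalued function `β ∘ (1/z) ∘ β⁻¹`, as a correspondence on `ℂ`: `y` is an image of `x`
if `β(z) = x` and `β(1/z) = y` for some point `z` of the sphere. -/
def kleinCorrespondence (x y : ℂ) : Prop :=
  ∃ z : OnePoint ℂ, toSphere beta z = (x : OnePoint ℂ) ∧
    toSphere beta (toSphere (1 / RatFunc.X) z) = (y : OnePoint ℂ)

end

end Recomposition

open Recomposition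

namespace Recomposition

open Polynomial Filter Topology

/-! An even morphism of degree two from an elliptic curve is a Möbius function of the
`x`-coordinate. Hence the functions of the form 𝓛_j are exactly the Möbius conjugates of the
duplication map on `x`-coordinates of any model y² = x (x² + a x + b) with j-invariant j
(`IsLattes.isConjugate`, `IsConjugate.isLattes`), and j is determined by the conjugacy class
(`Admissible.jInvariant_eq`).

Duplication is a two-isogeny φ followed by its dual φ̂. Exchanging the two gives the duplication of
the isogenous curve with parameters (-2a, a² - 4b), so two-isogenous curves have equivalent Lattès
maps.

Conversely, let a duplication map be U ∘ V. If V is Möbius, then V ∘ U is a conjugate of it.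
Otherwise V identifies almost every z with some w ≠ z. As duplication takes the same value at both,
w arises from z by translation by one of the three points of order two, and one of these serves
infinitely many z. With that point moved to (0, 0), V is invariant under z ↦ b / z, so V = g ∘ φ and
U ∘ g = φ̂. If g is Möbius, V ∘ U is conjugate to the dual duplication. If not, g factors through
φ̂, U is Möbius, and V ∘ U is conjugate to the original map. This is
`Admissible.isConjugate_of_invariant` and `Admissible.isConjugate_of_comp`: an elementary
transformation keeps j or moves it along one two-isogeny.

Finally, z = 4b / (a² - 4b) parametrizes the two-isogenies: the two j-invariants are β(z) and
β(1/z), and every z ≠ 0 occurs. The relation is symmetric under z ↦ 1/z, and it is Φ₂ = 0 because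
Φ₂(x, ·) splits over the three roots of β(z) = x (`Phi2_eq_prod`). -/

/-! ### Homogeneous coordinates and continuity of rational maps on the sphere. -/

lemma ratio_eq_ratio {a b c d : ℂ} (h₁ : ¬(a = 0 ∧ b = 0)) (h₂ : ¬(c = 0 ∧ d = 0))
    (h : a * d = c * b) : ratio a b = ratio c d := by
  unfold ratio
  by_cases hb : b = 0
  · have ha : a ≠ 0 := fun ha => h₁ ⟨ha, hb⟩
    have hd : d = 0 := by simpa [hb, ha] using h
    simp [hb, hd]
  · have hd : d ≠ 0 := by
      intro hd
      exact h₂ ⟨by simpa [hd, hb] using h.symm, hd⟩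
    have : a / b = c / d := by field_simp; linear_combination h
    simp [hb, hd, this]

lemma mul_eq_mul_of_ratio_eq_ratio {a b c d : ℂ} (h : ratio a b = ratio c d) :
    a * d = c * b := by
  unfold ratio at h
  by_cases hb : b = 0 <;> by_cases hd : d = 0
  · simp [hb, hd]
  · simp [hb, hd] at h
  · simp [hb, hd] at h
  · simp only [hb, hd, if_false, OnePoint.coe_eq_coe] at h
    field_simp at h
    linear_combination h

lemma ratio_of_ne_zero {a b : ℂ} (hb : b ≠ 0) : ratio a b = ((a / b : ℂ) : OnePoint ℂ) := by
  simp [ratio, hb]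

@[simp] lemma ratio_zero_right (a : ℂ) : ratio a 0 = OnePoint.infty := by simp [ratio]

lemma ratio_eq_infty_iff {a b : ℂ} : ratio a b = OnePoint.infty ↔ b = 0 := by
  unfold ratio
  split_ifs with h <;> simp [h]

lemma ratio_eq_coe_iff {a b c : ℂ} (h : ¬(a = 0 ∧ b = 0)) :
    ratio a b = (c : OnePoint ℂ) ↔ a = c * b := by
  unfold ratio
  split_ifs with hb
  · simp only [OnePoint.infty_ne_coe, hb, mul_zero, false_iff]
    exact fun ha => h ⟨ha, hb⟩
  · rw [OnePoint.coe_eq_coe, div_eq_iff hb]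

lemma ratio_mul_left {a b c : ℂ} (hc : c ≠ 0) : ratio (c * a) (c * b) = ratio a b := by
  unfold ratio
  by_cases hb : b = 0
  · simp [hb]
  · simp [hb, hc, mul_div_mul_left a b hc]

/-- The quotient `a / b` depends continuously on `(a, b) ≠ (0, 0)`. -/
lemma continuousAt_ratio {a b : ℂ} (h : ¬(a = 0 ∧ b = 0)) :
    ContinuousAt (fun p : ℂ × ℂ => ratio p.1 p.2) (a, b) := by
  by_cases hb : b = 0
  · have ha : a ≠ 0 := fun ha => h ⟨ha, hb⟩
    subst hb
    change Tendsto _ _ (𝓝 (ratio a 0))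
    rw [ratio_zero_right]
    rw [OnePoint.hasBasis_nhds_infty.tendsto_right_iff]
    rintro s ⟨-, hs⟩
    obtain ⟨R, hR⟩ := hs.isBounded.exists_norm_le
    have hopen : ∀ᶠ p : ℂ × ℂ in 𝓝 (a, 0), ‖p.2‖ * R < ‖p.1‖ := by
      have h1 : Continuous fun p : ℂ × ℂ => ‖p.2‖ * R := by fun_prop
      have h2 : Continuous fun p : ℂ × ℂ => ‖p.1‖ := by fun_prop
      exact (isOpen_lt h1 h2).mem_nhds (by simpa using ha)
    filter_upwards [hopen] with p hp
    by_cases h2 : p.2 = 0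
    · right; simp [h2]
    · left
      rw [ratio_of_ne_zero h2]
      refine ⟨_, ?_, rfl⟩
      intro hmem
      have := hR _ hmem
      rw [norm_div, div_le_iff₀ (norm_pos_iff.2 h2)] at this
      linarith
  · have : (fun p : ℂ × ℂ => ratio p.1 p.2) =ᶠ[𝓝 (a, b)]
        fun p => ((p.1 / p.2 : ℂ) : OnePoint ℂ) := by
      have : ∀ᶠ p : ℂ × ℂ in 𝓝 (a, b), p.2 ≠ 0 :=
        continuous_snd.continuousAt.eventually_ne hb
      filter_upwards [this] with p hp using ratio_of_ne_zero hp
    refine ContinuousAt.congr ?_ this.symm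
    exact OnePoint.continuous_coe.continuousAt.comp
      (continuousAt_fst.div continuousAt_snd hb)

/-- Reversing the coefficients turns `p z / z ^ m` into a polynomial in `1 / z`, to be evaluated at
0. -/
lemma tendsto_eval_div_pow {p : ℂ[X]} {m : ℕ} (hm : p.natDegree ≤ m) :
    Tendsto (fun z : ℂ => p.eval z / z ^ m) (cocompact ℂ) (𝓝 (p.coeff m)) := by
  have h1 : ∀ᶠ z : ℂ in cocompact ℂ, (p.reflect m).eval z⁻¹ = p.eval z / z ^ m := by
    have : ∀ᶠ z : ℂ in cocompact ℂ, z ≠ 0 :=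
      (isCompact_singleton (x := (0 : ℂ))).compl_mem_cocompact
    filter_upwards [this] with z hz
    let : Invertible z := invertibleOfNonzero hz
    have := eval₂_reflect_mul_pow (RingHom.id ℂ) z m p hm
    rw [eq_div_iff (pow_ne_zero _ hz)]
    simpa [eval₂_id, invOf_eq_inv] using this
  have h2 : Tendsto (fun z : ℂ => (p.reflect m).eval z⁻¹) (cocompact ℂ)
      (𝓝 ((p.reflect m).eval 0)) := by
    have h3 : Tendsto (fun z : ℂ => z⁻¹) (cocompact ℂ) (𝓝 0) := by
      rw [← Metric.cobounded_eq_cocompact]; exact tendsto_inv₀_cobounded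
    exact ((p.reflect m).continuous.tendsto 0).comp h3
  have h4 : (p.reflect m).eval 0 = p.coeff m := by
    rw [← coeff_zero_eq_eval_zero, coeff_reflect]
    rw [revAt_le (Nat.zero_le m), Nat.sub_zero]
  rw [← h4]
  exact h2.congr' h1

lemma num_denom_not_both_zero (f : RatFunc ℂ) (z : ℂ) :
    ¬(f.num.eval z = 0 ∧ f.denom.eval z = 0) := by
  rintro ⟨h1, h2⟩
  obtain ⟨u, v, huv⟩ := f.isCoprime_num_denom
  simpa [h1, h2] using congrArg (eval z) huv

lemma coeff_max_not_both_zero (f : RatFunc ℂ) :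
    ¬(f.num.coeff (max f.num.natDegree f.denom.natDegree) = 0 ∧
      f.denom.coeff (max f.num.natDegree f.denom.natDegree) = 0) := by
  rintro ⟨h1, h2⟩
  rcases le_total f.denom.natDegree f.num.natDegree with h | h
  · rw [max_eq_left h] at h1 h2
    have h3 : f.num = 0 := leadingCoeff_eq_zero.1 h1
    rw [h3, natDegree_zero, Nat.le_zero] at h
    rw [h3, natDegree_zero, ← h] at h2
    exact f.denom_ne_zero (leadingCoeff_eq_zero.1 h2)
  · rw [max_eq_right h] at h2
    exact f.denom_ne_zero (leadingCoeff_eq_zero.1 h2)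

lemma toSphere_coe (f : RatFunc ℂ) (z : ℂ) :
    toSphere f (z : OnePoint ℂ) = ratio (f.num.eval z) (f.denom.eval z) := rfl

lemma toSphere_infty (f : RatFunc ℂ) :
    toSphere f OnePoint.infty =
      ratio (f.num.coeff (max f.num.natDegree f.denom.natDegree))
        (f.denom.coeff (max f.num.natDegree f.denom.natDegree)) := rfl

lemma continuous_toSphere (f : RatFunc ℂ) : Continuous (toSphere f) := by
  rw [continuous_iff_continuousAt]
  intro x
  induction x using OnePoint.rec with
  | infty =>
    rw [OnePoint.continuousAt_infty', coclosedCompact_eq_cocompact, toSphere_infty]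
    have h := (continuousAt_ratio (coeff_max_not_both_zero f)).tendsto.comp
      ((tendsto_eval_div_pow (le_max_left f.num.natDegree f.denom.natDegree)).prodMk_nhds
        (tendsto_eval_div_pow (le_max_right f.num.natDegree f.denom.natDegree)))
    refine h.congr' ?_
    have : ∀ᶠ z : ℂ in cocompact ℂ, z ≠ 0 :=
      (isCompact_singleton (x := (0 : ℂ))).compl_mem_cocompact
    filter_upwards [this] with z hz
    simp only [Function.comp_apply, toSphere_coe, div_eq_inv_mul]
    exact ratio_mul_left (inv_ne_zero (pow_ne_zero _ hz))
  | coe z =>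
    rw [OnePoint.continuousAt_coe]
    exact (continuousAt_ratio (num_denom_not_both_zero f z)).comp
      (f := fun w => (f.num.eval w, f.denom.eval w))
      (f.num.continuous.prodMk f.denom.continuous).continuousAt

/-! ### Identities between rational functions, generic values and composition. -/

/-- The quotient of two polynomials as a rational function. -/
noncomputable def frac (p q : ℂ[X]) : RatFunc ℂ :=
  algebraMap ℂ[X] (RatFunc ℂ) p / algebraMap ℂ[X] (RatFunc ℂ) q

lemma frac_num_denom (f : RatFunc ℂ) : frac f.num f.denom = f := f.num_div_denom

lemma num_frac_mul {p q : ℂ[X]} (hq : q ≠ 0) : (frac p q).num * q = p * (frac p q).denom :=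
  (RatFunc.num_mul_eq_mul_denom_iff hq).2 rfl

lemma toSphere_frac_coe {p q : ℂ[X]} {z : ℂ} (h : ¬(p.eval z = 0 ∧ q.eval z = 0))
    (hq : q ≠ 0) : toSphere (frac p q) z = ratio (p.eval z) (q.eval z) := by
  rw [toSphere_coe]
  refine ratio_eq_ratio (num_denom_not_both_zero _ _) h ?_
  simpa using congrArg (eval z) (num_frac_mul (p := p) hq)

lemma toSphere_frac {p q : ℂ[X]} {z : ℂ} (hq : q.eval z ≠ 0) :
    toSphere (frac p q) z = ((p.eval z / q.eval z : ℂ) : OnePoint ℂ) := by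
  rw [toSphere_frac_coe (fun h => hq h.2) (by rintro rfl; simp at hq), ratio_of_ne_zero hq]

lemma toSphere_frac_infty {p q : ℂ[X]} (hq : q ≠ 0) (h : q.natDegree < p.natDegree) :
    toSphere (frac p q) OnePoint.infty = OnePoint.infty := by
  rw [toSphere_infty, ratio_eq_infty_iff]
  have hp : p ≠ 0 := by rintro rfl; simp at h
  have h0 := num_frac_mul (p := p) hq
  have hn : (frac p q).num ≠ 0 := by
    intro hn
    rw [hn, zero_mul] at h0
    exact mul_ne_zero hp (RatFunc.denom_ne_zero _) h0.symm
  have h1 := congrArg natDegree h0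
  rw [natDegree_mul hn hq, natDegree_mul hp (RatFunc.denom_ne_zero _)] at h1
  exact coeff_eq_zero_of_natDegree_lt (lt_max_of_lt_left (by omega))

lemma eventually_eval_ne_zero {p : ℂ[X]} (hp : p ≠ 0) :
    ∀ᶠ z in cofinite, p.eval z ≠ 0 := by
  rw [Filter.eventually_cofinite]
  refine (p.rootSet_finite ℂ).subset fun z hz => ?_
  rw [mem_rootSet]
  exact ⟨hp, by simpa using hz⟩

/-- Continuous self-maps of the sphere that agree at almost all complex numbers are equal. -/
lemma ext_of_eventually_eq {F G : OnePoint ℂ → OnePoint ℂ} (hF : Continuous F)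
    (hG : Continuous G) (h : ∀ᶠ z : ℂ in cofinite, F z = G z) : F = G := by
  have hd : Dense {z : ℂ | F z = G z} := by
    have h2 := Filter.eventually_cofinite.1 h
    have h3 : {z : ℂ | F z = G z} = {z : ℂ | ¬ F z = G z}ᶜ := by ext; simp
    rw [h3]
    exact h2.countable.dense_compl ℂ
  have hd2 : Dense ((fun z : ℂ => (z : OnePoint ℂ)) '' {z : ℂ | F z = G z}) :=
    OnePoint.denseRange_coe.dense_image OnePoint.continuous_coe hd
  refine Continuous.ext_on hd2 hF hG ?_
  rintro _ ⟨z, hz, rfl⟩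
  exact hz

lemma eventually_toSphere (f : RatFunc ℂ) : ∀ᶠ z : ℂ in cofinite,
    f.denom.eval z ≠ 0 ∧
      toSphere f z = ((f.num.eval z / f.denom.eval z : ℂ) : OnePoint ℂ) := by
  filter_upwards [eventually_eval_ne_zero f.denom_ne_zero] with z hz
  exact ⟨hz, by rw [toSphere_coe, ratio_of_ne_zero hz]⟩

/-- Two rational functions that agree at infinitely many points are equal. -/
lemma eq_of_infinite {f g : RatFunc ℂ} (h : {z : ℂ | toSphere f z = toSphere g z}.Infinite) :
    f = g := by
  have h1 : f.num * g.denom = g.num * f.denom := by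
    refine eq_of_infinite_eval_eq _ _ (h.mono fun z hz => ?_)
    simpa using mul_eq_mul_of_ratio_eq_ratio hz
  rw [← f.num_div_denom, ← g.num_div_denom, div_eq_div_iff]
  · rw [← map_mul, ← map_mul, h1]
  · simpa using f.denom_ne_zero
  · simpa using g.denom_ne_zero

lemma infinite_of_eventually {P : ℂ → Prop} (h : ∀ᶠ z in cofinite, P z) : {z | P z}.Infinite :=
  h.frequently.mono (fun _ h => h) |> Filter.frequently_cofinite_iff_infinite.1

/-- A rational function is constant. -/
def IsConst (f : RatFunc ℂ) : Prop := ∃ c : OnePoint ℂ, ∀ z, toSphere f z = c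

/-- A finite value taken infinitely often would make `f` agree infinitely often with a constant
function, hence equal it; the value infinity occurs only at zeros of the denominator. -/
lemma eventually_ne_of_not_isConst {f : RatFunc ℂ} (hf : ¬IsConst f) (c : OnePoint ℂ) :
    ∀ᶠ z : ℂ in cofinite, toSphere f z ≠ c := by
  induction c using OnePoint.rec with
  | infty =>
    filter_upwards [eventually_toSphere f] with z hz
    rw [hz.2]
    exact OnePoint.coe_ne_infty _
  | coe c =>
    rw [Filter.eventually_cofinite]
    by_contra hinf
    have hc : ∀ z : ℂ, toSphere (frac (C c) 1) z = (c : OnePoint ℂ) := fun z => by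
      rw [toSphere_frac (by simp)]; simp
    have h1 : toSphere f = fun _ => (c : OnePoint ℂ) := by
      have : f = frac (C c) 1 := eq_of_infinite (Set.Infinite.mono (fun z hz => by
        simp only [Set.mem_ofPred_eq, not_not] at hz ⊢
        rw [hz, hc]) hinf)
      rw [this]
      exact ext_of_eventually_eq (continuous_toSphere _) continuous_const
        (Filter.Eventually.of_forall hc)
    exact hf ⟨c, fun z => by rw [h1]⟩

/-- Each of the finitely many bad values is taken only finitely often. This allows generic
conditions to be imposed on `f z` as well as on `z`. -/
lemma eventually_comp {f : RatFunc ℂ} (hf : ¬IsConst f) {P : ℂ → Prop}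
    (hP : ∀ᶠ z in cofinite, P z) :
    ∀ᶠ z : ℂ in cofinite, ∃ w : ℂ, toSphere f z = w ∧ P w := by
  have hfin := Filter.eventually_cofinite.1 hP
  have h1 : ∀ᶠ z : ℂ in cofinite, ∀ w ∈ {w | ¬P w}, toSphere f z ≠ (w : OnePoint ℂ) :=
    (Set.Finite.eventually_all hfin).2 fun w _ => eventually_ne_of_not_isConst hf w
  filter_upwards [h1, eventually_ne_of_not_isConst hf OnePoint.infty] with z hz hz2
  obtain ⟨w, hw⟩ := OnePoint.ne_infty_iff_exists.1 hz2
  refine ⟨w, hw.symm, ?_⟩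
  by_contra hPw
  exact hz w hPw hw.symm

/-- Using the same exponent `m` for numerator and denominator of an outer function lets the powers
of `Q` cancel in the quotient. -/
lemma exists_eval_homogenize (p P Q : ℂ[X]) (m : ℕ) (hm : p.natDegree ≤ m) :
    ∃ r : ℂ[X], ∀ z, Q.eval z ≠ 0 → r.eval z = p.eval (P.eval z / Q.eval z) * Q.eval z ^ m := by
  refine ⟨∑ i ∈ Finset.range (m + 1), C (p.coeff i) * P ^ i * Q ^ (m - i), fun z hz => ?_⟩
  rw [eval_finsetSum, eval_eq_sum_range' (Nat.lt_succ_of_le hm), Finset.sum_mul]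
  refine Finset.sum_congr rfl fun i hi => ?_
  have hi' : i ≤ m := Nat.lt_succ_iff.1 (Finset.mem_range.1 hi)
  have : Q.eval z ^ m = Q.eval z ^ i * Q.eval z ^ (m - i) := by
    rw [← pow_add, Nat.add_sub_cancel' hi']
  simp only [eval_mul, eval_C, eval_pow, div_pow, this]
  field_simp

/-- The composition of rational functions, the inner one not constant, is a rational function. -/
lemma exists_comp (f : RatFunc ℂ) {g : RatFunc ℂ} (hg : ¬IsConst g) :
    ∃ h : RatFunc ℂ, toSphere h = toSphere f ∘ toSphere g := by
  set m := max f.num.natDegree f.denom.natDegree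
  obtain ⟨r, hr⟩ := exists_eval_homogenize f.num g.num g.denom m (le_max_left _ _)
  obtain ⟨s, hs⟩ := exists_eval_homogenize f.denom g.num g.denom m (le_max_right _ _)
  refine ⟨frac r s, ext_of_eventually_eq (continuous_toSphere _)
    ((continuous_toSphere _).comp (continuous_toSphere _)) ?_⟩
  filter_upwards [eventually_toSphere g, eventually_comp hg (eventually_toSphere f)]
    with z hz ⟨w, hw, hfw, hfw2⟩
  have hw' : w = g.num.eval z / g.denom.eval z := by
    rw [hz.2, OnePoint.coe_eq_coe] at hw; exact hw.symm
  have hsz := hs z hz.1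
  have hrz := hr z hz.1
  rw [← hw'] at hsz hrz
  have hpow : g.denom.eval z ^ m ≠ 0 := pow_ne_zero _ hz.1
  rw [toSphere_frac (by rw [hsz]; exact mul_ne_zero hfw hpow), Function.comp_apply, hw, hfw2,
    hrz, hsz, mul_div_mul_right _ _ hpow]

/-! ### Möbius transformations, conjugacy and elementary transformations. -/

/-- `f` and `g` are mutually inverse, as maps of the sphere. -/
def IsInversePair (f g : RatFunc ℂ) : Prop :=
  (∀ z, toSphere f (toSphere g z) = z) ∧ ∀ z, toSphere g (toSphere f z) = z

lemma IsInversePair.symm {f g : RatFunc ℂ} (h : IsInversePair f g) : IsInversePair g f :=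
  ⟨h.2, h.1⟩

lemma IsInversePair.not_isConst {f g : RatFunc ℂ} (h : IsInversePair f g) : ¬IsConst f := by
  rintro ⟨c, hc⟩
  have h1 := h.1 OnePoint.infty
  have h2 := h.1 ((0 : ℂ) : OnePoint ℂ)
  rw [hc] at h1 h2
  exact OnePoint.coe_ne_infty (0 : ℂ) (h2.symm.trans h1)

/-- The rational function `(α z + β) / (γ z + δ)`. -/
noncomputable def moebius (α β γ δ : ℂ) : RatFunc ℂ :=
  frac (C α * X + C β) (C γ * X + C δ)

lemma moebius_denom_ne_zero {α β γ δ : ℂ} (h : α * δ - β * γ ≠ 0) :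
    (C γ * X + C δ : ℂ[X]) ≠ 0 := by
  intro h0
  have h1 := congrArg (fun p => coeff p 1) h0
  have h2 := congrArg (fun p => coeff p 0) h0
  simp at h1 h2
  simp [h1, h2] at h

lemma toSphere_moebius {α β γ δ : ℂ} (h : α * δ - β * γ ≠ 0) (z : ℂ) :
    toSphere (moebius α β γ δ) z = ratio (α * z + β) (γ * z + δ) := by
  unfold moebius
  rw [toSphere_frac_coe]
  · simp
  · rintro ⟨h1, h2⟩
    simp at h1 h2
    by_cases hα : α = 0
    · simp [hα] at h1
      simp [hα, h1] at h
    · apply h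
      have : α * (α * δ - β * γ) = 0 := by linear_combination α * α * h2 - α * γ * h1
      simpa [hα] using this
  · exact moebius_denom_ne_zero h

lemma eventually_toSphere_moebius {α β γ δ : ℂ} (h : α * δ - β * γ ≠ 0) :
    ∀ᶠ z : ℂ in cofinite, γ * z + δ ≠ 0 ∧ toSphere (moebius α β γ δ) z =
      (((α * z + β) / (γ * z + δ) : ℂ) : OnePoint ℂ) := by
  filter_upwards [eventually_eval_ne_zero (moebius_denom_ne_zero h)] with z hz
  simp only [eval_add, eval_mul, eval_C, eval_X] at hz
  exact ⟨hz, by rw [toSphere_moebius h, ratio_of_ne_zero hz]⟩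

lemma moebius_not_isConst {α β γ δ : ℂ} (h : α * δ - β * γ ≠ 0) :
    ¬IsConst (moebius α β γ δ) := by
  rintro ⟨c, hc⟩
  obtain ⟨z, hz⟩ := (infinite_of_eventually (eventually_toSphere_moebius h)).nonempty
  obtain ⟨w, hw⟩ := ((infinite_of_eventually (eventually_toSphere_moebius h)).sdiff
    (Set.finite_singleton z)).nonempty
  have h1 := (hc z).trans (hc w).symm
  rw [hz.2, hw.1.2, OnePoint.coe_eq_coe, div_eq_div_iff hz.1 hw.1.1] at h1
  have h2 : (α * δ - β * γ) * (z - w) = 0 := by linear_combination h1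
  rcases mul_eq_zero.1 h2 with h3 | h3
  · exact h h3
  · exact hw.2 (sub_eq_zero.1 h3).symm

lemma moebius_leftInverse {α β γ δ : ℂ} (h : α * δ - β * γ ≠ 0) (z : OnePoint ℂ) :
    toSphere (moebius δ (-β) (-γ) α) (toSphere (moebius α β γ δ) z) = z := by
  have h' : δ * α - -β * -γ ≠ 0 := by convert h using 1; ring
  have : toSphere (moebius δ (-β) (-γ) α) ∘ toSphere (moebius α β γ δ) = id := by
    refine ext_of_eventually_eq ((continuous_toSphere _).comp (continuous_toSphere _))
      continuous_id ?_
    filter_upwards [eventually_toSphere_moebius h,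
      eventually_comp (moebius_not_isConst h) (eventually_toSphere_moebius h')]
      with z hz ⟨w, hw, hw1, hw2⟩
    rw [Function.comp_apply, hw, hw2]
    rw [hz.2, OnePoint.coe_eq_coe] at hw
    simp only [id_eq, OnePoint.coe_eq_coe]
    rw [div_eq_iff (by simpa using hw1)]
    rw [div_eq_iff hz.1] at hw
    linear_combination -hw
  exact congrFun this z

lemma isInversePair_moebius {α β γ δ : ℂ} (h : α * δ - β * γ ≠ 0) :
    IsInversePair (moebius α β γ δ) (moebius δ (-β) (-γ) α) := by
  refine ⟨fun z => ?_, moebius_leftInverse h⟩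
  have := moebius_leftInverse (α := δ) (β := -β) (γ := -γ) (δ := α)
    (by convert h using 1; ring) z
  simpa using this

/-- A rational function that is not constant is either a Möbius transformation, or it takes its
value at almost every complex number at some other complex number as well. -/
lemma moebius_or_not_injective {f : RatFunc ℂ} (hf : ¬IsConst f) :
    (∃ α β γ δ : ℂ, α * δ - β * γ ≠ 0 ∧ f = moebius α β γ δ) ∨
      ∀ᶠ z : ℂ in cofinite, ∃ w : ℂ, w ≠ z ∧ toSphere f w = toSphere f z := by
  by_cases hdeg : max f.num.natDegree f.denom.natDegree ≤ 1
  · left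
    obtain ⟨hn, hd⟩ := max_le_iff.1 hdeg
    obtain ⟨α, β, hαβ⟩ := exists_eq_X_add_C_of_natDegree_le_one hn
    obtain ⟨γ, δ, hγδ⟩ := exists_eq_X_add_C_of_natDegree_le_one hd
    refine ⟨α, β, γ, δ, fun h0 => hf ?_, by rw [moebius, ← hαβ, ← hγδ, frac_num_denom]⟩
    have hfin := infinite_of_eventually (eventually_toSphere f)
    obtain ⟨w, hw⟩ := hfin.nonempty
    refine ⟨toSphere f w, fun z => ?_⟩
    have : f = frac (C (f.num.eval w / f.denom.eval w)) 1 := by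
      refine eq_of_infinite (hfin.mono fun z hz => ?_)
      show _ = _
      rw [hz.2, toSphere_frac (by simp), OnePoint.coe_eq_coe]
      have h1 := hz.1
      have h2 := hw.1
      simp only [eval_C, eval_one, div_one]
      rw [div_eq_div_iff h1 h2, hαβ, hγδ]
      simp
      linear_combination (z - w) * h0
    rw [hw.2]
    have hc : toSphere f = fun _ => ((f.num.eval w / f.denom.eval w : ℂ) : OnePoint ℂ) := by
      refine ext_of_eventually_eq (continuous_toSphere _) continuous_const ?_
      refine Filter.Eventually.of_forall fun z => ?_
      conv_lhs => rw [this]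
      rw [toSphere_frac (by simp)]
      simp
    rw [hc]
  · right
    push Not at hdeg
    -- The critical points are the zeros of a Wronskian. It is not zero, since coprime polynomials
    -- with zero Wronskian are constant.
    have hW : f.num.derivative * f.denom - f.num * f.denom.derivative ≠ 0 := by
      intro h0
      have := (IsCoprime.wronskian_eq_zero_iff f.isCoprime_num_denom).1
        (by rw [wronskian]; linear_combination -h0)
      rw [derivative_eq_zero.1 this.1, derivative_eq_zero.1 this.2] at hdeg
      simp at hdeg
    filter_upwards [eventually_toSphere f, eventually_eval_ne_zero hW,
      eventually_ne_of_not_isConst hf (toSphere f OnePoint.infty)] with z hz hWz hinf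
    set p := f.num
    set q := f.denom
    set m := max p.natDegree q.natDegree
    -- The roots of `h` are the finite points in the fibre of `f z`. As `f z` is not the value at
    -- infinity, `h` has full degree `m ≥ 2`; as `z` is not critical, it is a simple root, so
    -- another root exists.
    set h : ℂ[X] := C (q.eval z) * p - C (p.eval z) * q with hh
    have hroot : h.IsRoot z := by simp [hh, IsRoot]; ring
    have hcm : h.coeff m ≠ 0 := by
      intro h0
      apply hinf
      rw [toSphere_coe, toSphere_infty]
      refine ratio_eq_ratio (num_denom_not_both_zero _ _) (coeff_max_not_both_zero f) ?_
      simp only [hh, coeff_sub, coeff_C_mul] at h0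
      linear_combination -h0
    obtain ⟨k, hk⟩ := dvd_iff_isRoot.2 hroot
    have hkdeg : k.degree ≠ 0 := by
      intro h0
      rw [eq_C_of_degree_eq_zero h0] at hk
      apply hcm
      apply coeff_eq_zero_of_natDegree_lt
      refine lt_of_le_of_lt ?_ hdeg
      rw [hk]
      compute_degree
    obtain ⟨w, hw⟩ := IsAlgClosed.exists_root k hkdeg
    have hder : h.derivative.eval z = k.eval z := by rw [hk]; simp
    refine ⟨w, ?_, ?_⟩
    · rintro rfl
      rw [hw.eq_zero] at hder
      apply hWz
      simp [hh] at hder ⊢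
      linear_combination hder
    · have h1 : h.eval w = 0 := by rw [hk]; simp [hw.eq_zero]
      simp only [hh, eval_sub, eval_mul, eval_C] at h1
      rw [toSphere_coe, toSphere_coe]
      refine ratio_eq_ratio (num_denom_not_both_zero _ _) (num_denom_not_both_zero _ _) ?_
      linear_combination h1

lemma inversePair_or_not_injective {f : RatFunc ℂ} (hf : ¬IsConst f) :
    (∃ g, IsInversePair f g) ∨
      ∀ᶠ z : ℂ in cofinite, ∃ w : ℂ, w ≠ z ∧ toSphere f w = toSphere f z := by
  rcases moebius_or_not_injective hf with ⟨α, β, γ, δ, h, rfl⟩ | h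
  · exact Or.inl ⟨_, isInversePair_moebius h⟩
  · exact Or.inr h

lemma IsInversePair.eq_moebius {f g : RatFunc ℂ} (h : IsInversePair f g) :
    ∃ α β γ δ : ℂ, α * δ - β * γ ≠ 0 ∧ f = moebius α β γ δ := by
  rcases moebius_or_not_injective h.not_isConst with h1 | h1
  · exact h1
  · obtain ⟨z, w, hne, hw⟩ := (infinite_of_eventually h1).nonempty
    have := congrArg (toSphere g) hw
    rw [h.2, h.2, OnePoint.coe_eq_coe] at this
    exact absurd this hne

/-- `A` is conjugate to `B` by a Möbius transformation. -/
def IsConjugate (A B : RatFunc ℂ) : Prop :=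
  ∃ f g : RatFunc ℂ, IsInversePair f g ∧ ∀ z, toSphere A (toSphere f z) = toSphere f (toSphere B z)

lemma toSphere_X (z : OnePoint ℂ) : toSphere (frac X 1) z = z := by
  have : toSphere (frac X 1) = id := by
    refine ext_of_eventually_eq (continuous_toSphere _) continuous_id
      (Filter.Eventually.of_forall fun z => ?_)
    rw [toSphere_frac (by simp)]
    simp
  exact congrFun this z

lemma IsConjugate.refl (A : RatFunc ℂ) : IsConjugate A A :=
  ⟨frac X 1, frac X 1, ⟨fun z => by simp [toSphere_X], fun z => by simp [toSphere_X]⟩,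
    fun z => by simp [toSphere_X]⟩

lemma IsConjugate.symm {A B : RatFunc ℂ} (h : IsConjugate A B) : IsConjugate B A := by
  obtain ⟨f, g, hfg, h⟩ := h
  refine ⟨g, f, hfg.symm, fun z => ?_⟩
  have := congrArg (toSphere g) (h (toSphere g z))
  rw [hfg.1, hfg.2] at this
  exact this.symm

lemma IsInversePair.comp {f g f' g' h k : RatFunc ℂ} (h₁ : IsInversePair f g)
    (h₂ : IsInversePair f' g') (hh : toSphere h = toSphere f ∘ toSphere f')
    (hk : toSphere k = toSphere g' ∘ toSphere g) : IsInversePair h k := by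
  constructor <;> intro z <;> simp [hh, hk, h₁.1, h₁.2, h₂.1, h₂.2]

lemma IsConjugate.trans {A B D : RatFunc ℂ} (h₁ : IsConjugate A B) (h₂ : IsConjugate B D) :
    IsConjugate A D := by
  obtain ⟨f, g, hfg, h₁⟩ := h₁
  obtain ⟨f', g', hfg', h₂⟩ := h₂
  obtain ⟨h, hh⟩ := exists_comp f hfg'.not_isConst
  obtain ⟨k, hk⟩ := exists_comp g' hfg.symm.not_isConst
  refine ⟨h, k, hfg.comp hfg' hh hk, fun z => ?_⟩
  simp [hh, h₁, h₂]

lemma IsConst.of_inversePair_comp {f g A : RatFunc ℂ} (h : IsInversePair f g)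
    (hA : ∃ c, ∀ z, toSphere f (toSphere A z) = c) : IsConst A := by
  obtain ⟨c, hc⟩ := hA
  exact ⟨toSphere g c, fun z => by rw [← hc z, h.2]⟩

/-- With `g` the inverse of `f`, one has A = f ∘ (g ∘ A) and (g ∘ A) ∘ f = B. -/
lemma IsConjugate.isElementaryTransformation {A B : RatFunc ℂ} (h : IsConjugate A B)
    (hB : ¬IsConst B) : IsElementaryTransformation A B := by
  obtain ⟨f, g, hfg, h⟩ := h
  have hA : ¬IsConst A := by
    rintro ⟨c, hc⟩
    exact hB (IsConst.of_inversePair_comp hfg ⟨c, fun z => by rw [← h, hc]⟩)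
  obtain ⟨V, hV⟩ := exists_comp g hA
  refine ⟨f, V, ?_, ?_⟩
  · funext z
    simp [hV, hfg.1]
  · funext z
    simp [hV, h, hfg.2]

lemma IsElementaryTransformation.symm {A B : RatFunc ℂ} (h : IsElementaryTransformation A B) :
    IsElementaryTransformation B A := by
  obtain ⟨U, V, h₁, h₂⟩ := h
  exact ⟨V, U, h₂, h₁⟩

lemma Equivalent.symm {A B : RatFunc ℂ} (h : Equivalent A B) : Equivalent B A := by
  induction h with
  | refl => exact .refl
  | tail _ h ih => exact ih.head h.symm

/-! ### Two-isogenies and duplication on `x`-coordinates. -/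

/-- The quotient map `x ↦ k (x² + a x + b) / x` by the involution `x ↦ b / x`. For `k = 1` it is,
in terms of `x`-coordinates, the quotient of `y² = x (x² + a x + b)` by its point `(0, 0)`. -/
noncomputable def twoIsogeny (k a b : ℂ) : RatFunc ℂ :=
  frac (C k * (X ^ 2 + C a * X + C b)) X

/-- The duplication map of `y² = x (x² + a x + b)` in terms of `x`-coordinates. -/
noncomputable def duplication (a b : ℂ) : RatFunc ℂ :=
  frac ((X ^ 2 - C b) ^ 2) (C 4 * (X * (X ^ 2 + C a * X + C b)))

/-- The cubic polynomial `x (x² + a x + b)` has distinct roots. -/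
def Admissible (a b : ℂ) : Prop := b ^ 2 * (a ^ 2 - 4 * b) ≠ 0

/-- The `j`-invariant of `y² = x (x² + a x + b)`. -/
noncomputable def jInvariant (a b : ℂ) : ℂ :=
  256 * (a ^ 2 - 3 * b) ^ 3 / (b ^ 2 * (a ^ 2 - 4 * b))

lemma Admissible.left {a b : ℂ} (h : Admissible a b) : b ≠ 0 := by
  rintro rfl; simp [Admissible] at h

lemma Admissible.right {a b : ℂ} (h : Admissible a b) : a ^ 2 - 4 * b ≠ 0 :=
  fun h0 => h (by rw [h0, mul_zero])

lemma Admissible.dual {a b : ℂ} (h : Admissible a b) : Admissible (-2 * a) (a ^ 2 - 4 * b) := by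
  have : (a ^ 2 - 4 * b) ^ 2 * ((-2 * a) ^ 2 - 4 * (a ^ 2 - 4 * b)) =
      16 * ((a ^ 2 - 4 * b) ^ 2 * b) := by ring
  unfold Admissible
  rw [this]
  exact mul_ne_zero (by norm_num) (mul_ne_zero (pow_ne_zero _ h.right) h.left)

lemma toSphere_twoIsogeny {z : ℂ} (hz : z ≠ 0) (k a b : ℂ) :
    toSphere (twoIsogeny k a b) z = ((k * (z ^ 2 + a * z + b) / z : ℂ) : OnePoint ℂ) := by
  rw [twoIsogeny, toSphere_frac (by simpa using hz)]
  simp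

lemma toSphere_twoIsogeny_zero {k b : ℂ} (hk : k ≠ 0) (a : ℂ) (hb : b ≠ 0) :
    toSphere (twoIsogeny k a b) (0 : ℂ) = OnePoint.infty := by
  rw [twoIsogeny, toSphere_frac_coe (by simp [hk, hb]) X_ne_zero]
  simp

lemma toSphere_twoIsogeny_infty {k : ℂ} (hk : k ≠ 0) (a b : ℂ) :
    toSphere (twoIsogeny k a b) OnePoint.infty = OnePoint.infty := by
  refine toSphere_frac_infty X_ne_zero ?_
  have : (C k * (X ^ 2 + C a * X + C b)).natDegree = 2 := by
    rw [natDegree_C_mul hk]; compute_degree!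
  rw [this]; simp

lemma exists_quadratic_root (a b : ℂ) : ∃ z : ℂ, z ^ 2 + a * z + b = 0 := by
  obtain ⟨s, hs⟩ := IsAlgClosed.exists_pow_nat_eq (a ^ 2 - 4 * b) (n := 2) (by norm_num)
  exact ⟨(-a + s) / 2, by linear_combination hs / 4⟩

/-- Surjectivity is what allows a two-isogeny to be cancelled on the right of an identity of maps.
-/
lemma twoIsogeny_surjective {k b : ℂ} (hk : k ≠ 0) (a : ℂ) (hb : b ≠ 0) (w : OnePoint ℂ) :
    ∃ z, toSphere (twoIsogeny k a b) z = w := by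
  induction w using OnePoint.rec with
  | infty => exact ⟨_, toSphere_twoIsogeny_infty hk a b⟩
  | coe w =>
    obtain ⟨z, hz⟩ := exists_quadratic_root (a - w / k) b
    have hz0 : z ≠ 0 := by
      rintro rfl
      simp [hb] at hz
    refine ⟨z, ?_⟩
    rw [toSphere_twoIsogeny hz0, OnePoint.coe_eq_coe, div_eq_iff hz0]
    field_simp at hz
    linear_combination hz

lemma not_isConst_of_ne {f : RatFunc ℂ} {z w : OnePoint ℂ} (h : toSphere f z ≠ toSphere f w) :
    ¬IsConst f := fun ⟨_, hc⟩ => h ((hc z).trans (hc w).symm)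

lemma twoIsogeny_not_isConst {k : ℂ} (hk : k ≠ 0) (a b : ℂ) : ¬IsConst (twoIsogeny k a b) := by
  refine not_isConst_of_ne (z := OnePoint.infty) (w := (1 : ℂ)) ?_
  rw [toSphere_twoIsogeny_infty hk, toSphere_twoIsogeny one_ne_zero]
  exact OnePoint.infty_ne_coe _

lemma eventually_cubic_ne_zero (a b : ℂ) :
    ∀ᶠ z : ℂ in cofinite, z ≠ 0 ∧ z ^ 2 + a * z + b ≠ 0 := by
  have h : (X * (X ^ 2 + C a * X + C b) : ℂ[X]) ≠ 0 := by
    refine mul_ne_zero X_ne_zero (Monic.ne_zero ?_)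
    monicity!
  filter_upwards [eventually_eval_ne_zero h] with z hz
  simpa using hz

lemma duplication_denom_ne_zero (a b : ℂ) :
    (C 4 * (X * (X ^ 2 + C a * X + C b)) : ℂ[X]) ≠ 0 := by
  refine mul_ne_zero (by simp) (mul_ne_zero X_ne_zero (Monic.ne_zero ?_))
  monicity!

lemma toSphere_duplication {a b z : ℂ} (hz : z ≠ 0) (hz' : z ^ 2 + a * z + b ≠ 0) :
    toSphere (duplication a b) z =
      (((z ^ 2 - b) ^ 2 / (4 * (z * (z ^ 2 + a * z + b))) : ℂ) : OnePoint ℂ) := by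
  rw [duplication, toSphere_frac]
  · simp
  · simp [hz, hz']

/-- A common zero would satisfy z² = b and a z = -2b, whence a² = 4b. The duplication formula is
thus in lowest terms and gives the value at every finite point. -/
lemma Admissible.not_both_zero {a b : ℂ} (h : Admissible a b) (z : ℂ) :
    ¬((z ^ 2 - b) ^ 2 = 0 ∧ 4 * (z * (z ^ 2 + a * z + b)) = 0) := by
  rintro ⟨h1, h2⟩
  have h1 : z ^ 2 = b := by simpa [sub_eq_zero] using h1
  have hb := h.left
  have hz : z ≠ 0 := by rintro rfl; apply hb; rw [← h1]; simp
  have h2 : z ^ 2 + a * z + b = 0 := by simpa [hz] using h2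
  apply h.right
  have : b * (a ^ 2 - 4 * b) = 0 := by
    linear_combination (a * z - 2 * b) * h2 - (a ^ 2 + a * z - 2 * b) * h1
  simpa [hb] using this

lemma Admissible.toSphere_duplication {a b : ℂ} (h : Admissible a b) (z : ℂ) :
    toSphere (duplication a b) z = ratio ((z ^ 2 - b) ^ 2) (4 * (z * (z ^ 2 + a * z + b))) := by
  rw [duplication, toSphere_frac_coe]
  · simp
  · simpa using h.not_both_zero z
  · exact duplication_denom_ne_zero a b

lemma toSphere_duplication_infty (a b : ℂ) :
    toSphere (duplication a b) OnePoint.infty = OnePoint.infty := by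
  refine toSphere_frac_infty (duplication_denom_ne_zero a b) ?_
  have h1 : ((X ^ 2 - C b) ^ 2 : ℂ[X]).natDegree = 4 := by
    rw [natDegree_pow, natDegree_X_pow_sub_C]
  have h2 : (C 4 * (X * (X ^ 2 + C a * X + C b)) : ℂ[X]).natDegree ≤ 3 := by
    compute_degree
  omega

lemma duplication_not_isConst (a b : ℂ) : ¬IsConst (duplication a b) := by
  obtain ⟨z, hz, hz'⟩ := (infinite_of_eventually (eventually_cubic_ne_zero a b)).nonempty
  refine not_isConst_of_ne (z := OnePoint.infty) (w := z) ?_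
  rw [toSphere_duplication_infty, Recomposition.toSphere_duplication hz hz']
  exact OnePoint.infty_ne_coe _

/-- Duplication is the composition of a two-isogeny with its dual. -/
lemma toSphere_duplication_eq (a b : ℂ) (z : OnePoint ℂ) : toSphere (duplication a b) z =
    toSphere (twoIsogeny (1 / 4) (-2 * a) (a ^ 2 - 4 * b)) (toSphere (twoIsogeny 1 a b) z) := by
  have : toSphere (duplication a b) =
      toSphere (twoIsogeny (1 / 4) (-2 * a) (a ^ 2 - 4 * b)) ∘ toSphere (twoIsogeny 1 a b) := by
    refine ext_of_eventually_eq (continuous_toSphere _)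
      ((continuous_toSphere _).comp (continuous_toSphere _)) ?_
    filter_upwards [eventually_cubic_ne_zero a b] with z ⟨hz, hz'⟩
    rw [Function.comp_apply, toSphere_twoIsogeny hz, one_mul,
      toSphere_twoIsogeny (div_ne_zero hz' hz), toSphere_duplication hz hz', OnePoint.coe_eq_coe]
    field_simp
    ring
  exact congrFun this z

/-- Applying (a, b) ↦ (-2a, a² - 4b) twice gives (4a, 16b), which is the original curve with `x`
scaled by 4; the factor `1 / 4` in the dual isogeny undoes this scaling. -/
lemma toSphere_duplication_dual_eq (a b : ℂ) (z : OnePoint ℂ) :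
    toSphere (duplication (-2 * a) (a ^ 2 - 4 * b)) z =
      toSphere (twoIsogeny 1 a b)
        (toSphere (twoIsogeny (1 / 4) (-2 * a) (a ^ 2 - 4 * b)) z) := by
  have : toSphere (duplication (-2 * a) (a ^ 2 - 4 * b)) =
      toSphere (twoIsogeny 1 a b) ∘
        toSphere (twoIsogeny (1 / 4) (-2 * a) (a ^ 2 - 4 * b)) := by
    refine ext_of_eventually_eq (continuous_toSphere _)
      ((continuous_toSphere _).comp (continuous_toSphere _)) ?_
    filter_upwards [eventually_cubic_ne_zero (-2 * a) (a ^ 2 - 4 * b)] with z ⟨hz, hz'⟩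
    have hw : 1 / 4 * (z ^ 2 + -2 * a * z + (a ^ 2 - 4 * b)) / z ≠ 0 :=
      div_ne_zero (mul_ne_zero (by norm_num) hz') hz
    rw [Function.comp_apply, toSphere_twoIsogeny hz, toSphere_twoIsogeny hw,
      toSphere_duplication hz hz', OnePoint.coe_eq_coe]
    generalize hq : z ^ 2 + -2 * a * z + (a ^ 2 - 4 * b) = q at *
    rw [div_eq_div_iff (by simp [hz, hz']) hw]
    field_simp
    rw [← hq]
    ring
  exact congrFun this z

lemma duplication_isElementaryTransformation_dual (a b : ℂ) :
    IsElementaryTransformation (duplication a b) (duplication (-2 * a) (a ^ 2 - 4 * b)) :=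
  ⟨twoIsogeny (1 / 4) (-2 * a) (a ^ 2 - 4 * b), twoIsogeny 1 a b,
    funext (toSphere_duplication_eq a b), funext (toSphere_duplication_dual_eq a b)⟩

/-! ### Descent of invariant functions through a two-isogeny. -/

/-- If x denotes the value of the quotient map at z, then z² = (x / k - a) z - b, so 1 and z span
ℂ[z] over ℂ[x]. -/
lemma exists_eval_eq_add_mul (k a b : ℂ) (hk : k ≠ 0) (p : ℂ[X]) :
    ∃ A B : ℂ[X], ∀ z : ℂ, z ≠ 0 → p.eval z =
      A.eval (k * (z ^ 2 + a * z + b) / z) + z * B.eval (k * (z ^ 2 + a * z + b) / z) := by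
  induction p using Polynomial.induction_on' with
  | add p q hp hq =>
    obtain ⟨A, B, h⟩ := hp
    obtain ⟨A', B', h'⟩ := hq
    refine ⟨A + A', B + B', fun z hz => ?_⟩
    rw [eval_add, h z hz, h' z hz, eval_add, eval_add]
    ring
  | monomial n c =>
    induction n with
    | zero => exact ⟨C c, 0, fun z _ => by simp⟩
    | succ n ih =>
      obtain ⟨A, B, h⟩ := ih
      refine ⟨C (-b) * B, A + (C k⁻¹ * X - C a) * B, fun z hz => ?_⟩
      rw [← monomial_mul_X, eval_mul, h z hz]
      simp only [eval_mul, eval_add, eval_sub, eval_C, eval_X]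
      field_simp
      ring

/-- A rational function that is invariant under `z ↦ b / z` is a rational function of the
quotient map. -/
lemma exists_comp_twoIsogeny {k a b : ℂ} (hk : k ≠ 0) (hb : b ≠ 0) {V : RatFunc ℂ}
    (hV : {z : ℂ | z ≠ 0 ∧ toSphere V z = toSphere V (b / z : ℂ)}.Infinite) :
    ∃ g : RatFunc ℂ, ∀ z, toSphere V z = toSphere g (toSphere (twoIsogeny k a b) z) := by
  have hdet : (0 : ℂ) * 0 - b * 1 ≠ 0 := by simpa using hb
  have hσ : ∀ z : ℂ, z ≠ 0 → toSphere (moebius 0 b 1 0) z = ((b / z : ℂ) : OnePoint ℂ) :=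
    fun z hz => by
      rw [toSphere_moebius hdet, ratio_of_ne_zero (by simpa using hz)]; simp
  -- `V` and its composite with z ↦ b / z agree infinitely often, so they are the same rational
  -- function.
  have hinv : ∀ z : ℂ, z ≠ 0 → toSphere V z = toSphere V (b / z : ℂ) := by
    obtain ⟨h, hh⟩ := exists_comp V (moebius_not_isConst hdet)
    have hVh : V = h := by
      refine eq_of_infinite (hV.mono ?_)
      rintro z ⟨hz, h1⟩
      show _ = _
      rw [hh, Function.comp_apply, hσ z hz, h1]
    intro z hz
    conv_lhs => rw [hVh, hh, Function.comp_apply, hσ z hz]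
  obtain ⟨A, B, hAB⟩ := exists_eval_eq_add_mul k a b hk V.num
  obtain ⟨A', B', hAB'⟩ := exists_eval_eq_add_mul k a b hk V.denom
  -- With w = b / z, `T` is the trace z + w and `D` the norm of the denominator of `V`. The quotient
  -- of `2 * N + T * M` by `2 * D` is the average of V(z) and V(w), which equals V(z) by invariance.
  set T : ℂ[X] := C k⁻¹ * X - C a
  set N : ℂ[X] := A * A' + C b * (B * B') + T * (A * B') with hN
  set M : ℂ[X] := B * A' - A * B' with hM
  set D : ℂ[X] := A' * A' + T * (A' * B') + C b * (B' * B') with hD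
  have key : ∀ᶠ z : ℂ in cofinite, z ≠ 0 ∧ D.eval (k * (z ^ 2 + a * z + b) / z) ≠ 0 ∧
      toSphere V z = (((2 * N + T * M).eval (k * (z ^ 2 + a * z + b) / z) /
        (2 * D).eval (k * (z ^ 2 + a * z + b) / z) : ℂ) : OnePoint ℂ) := by
    filter_upwards [eventually_cubic_ne_zero a b, eventually_toSphere V,
      eventually_comp (moebius_not_isConst hdet) (eventually_toSphere V)]
      with z ⟨hz, _⟩ ⟨hd, hVz⟩ ⟨w, hw, hd', hVw⟩
    rw [hσ z hz, OnePoint.coe_eq_coe] at hw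
    have hw0 : w ≠ 0 := by rw [← hw]; exact div_ne_zero hb hz
    set x := k * (z ^ 2 + a * z + b) / z with hx
    have hxw : k * (w ^ 2 + a * w + b) / w = x := by
      rw [hx, ← hw]; field_simp; ring
    have hsum : z + w = x / k - a := by
      rw [hx, ← hw]; field_simp; ring
    have hprod : z * w = b := by rw [← hw]; field_simp
    have e1 := hAB z hz
    have e2 := hAB' z hz
    have e3 := hAB w hw0
    have e4 := hAB' w hw0
    rw [hxw] at e3 e4
    rw [← hx] at e1 e2
    have hT : T.eval x = z + w := by rw [hsum]; simp [T]; ring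
    have hDx : D.eval x = V.denom.eval z * V.denom.eval w := by
      simp only [hD, eval_add, eval_mul, eval_C, hT, e2, e4]
      rw [← hprod]; ring
    have hDne : D.eval x ≠ 0 := by rw [hDx]; exact mul_ne_zero hd hd'
    refine ⟨hz, hDne, ?_⟩
    have hval := hinv z hz
    rw [hw, hVz, hVw, OnePoint.coe_eq_coe, div_eq_div_iff hd hd'] at hval
    rw [hVz, OnePoint.coe_eq_coe, div_eq_div_iff hd (by simpa using hDne), eval_mul, hDx]
    have hNM : (2 * N + T * M).eval x =
        V.num.eval z * V.denom.eval w + V.num.eval w * V.denom.eval z := by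
      simp only [hN, hM, eval_add, eval_mul, eval_sub, eval_C, hT, e1, e2, e3, e4, eval_ofNat]
      rw [← hprod]; ring
    rw [hNM, eval_ofNat]
    linear_combination V.denom.eval z * hval
  refine ⟨frac (2 * N + T * M) (2 * D), fun z => ?_⟩
  have : toSphere V = toSphere (frac (2 * N + T * M) (2 * D)) ∘ toSphere (twoIsogeny k a b) := by
    refine ext_of_eventually_eq (continuous_toSphere _)
      ((continuous_toSphere _).comp (continuous_toSphere _)) ?_
    filter_upwards [key] with z ⟨hz, hDz, hVz⟩
    rw [Function.comp_apply, toSphere_twoIsogeny hz, toSphere_frac (by simpa using hDz), hVz]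
  exact congrFun this z

/-! ### The j-invariant as an invariant of conjugacy. -/

lemma Admissible.exists_roots {a b : ℂ} (h : Admissible a b) : ∃ r s : ℂ, r ≠ 0 ∧ s ≠ 0 ∧ r ≠ s ∧
    a = -(r + s) ∧ b = r * s := by
  obtain ⟨r, hr⟩ := exists_quadratic_root a b
  have hb : b = r * (-a - r) := by linear_combination hr
  have hb0 := h.left
  rw [hb] at hb0
  refine ⟨r, -a - r, left_ne_zero_of_mul hb0, right_ne_zero_of_mul hb0, fun h0 => h.right ?_,
    by ring, hb⟩
  linear_combination (-4) * hb + (a + 2 * r) * h0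

/-- Translating the cubic by a root `e` gives x (x² + (3e + a) x + (3e² + 2ae + b)), and translation
preserves the discriminant. -/
lemma shift_discriminant {a b e : ℂ} (he : e * (e ^ 2 + a * e + b) = 0) :
    (3 * e ^ 2 + 2 * a * e + b) ^ 2 *
      ((3 * e + a) ^ 2 - 4 * (3 * e ^ 2 + 2 * a * e + b)) = b ^ 2 * (a ^ 2 - 4 * b) := by
  linear_combination (4 * (3 * e + a) ^ 3 - 18 * (3 * e + a) * (3 * e ^ 2 + 2 * a * e + b) +
    27 * (e * (e ^ 2 + a * e + b))) * he

/-- The hypotheses say that x ↦ u x + e carries one cubic to a multiple of the other. Scaling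
multiplies the numerator and the denominator of the j-invariant by the same `u ^ 6`. -/
lemma jInvariant_eq_of_affine {a b a' b' u e : ℂ} (hu : u ≠ 0)
    (he : e * (e ^ 2 + a * e + b) = 0) (ha : 3 * e + a = u * a')
    (hb : 3 * e ^ 2 + 2 * a * e + b = u ^ 2 * b') : jInvariant a b = jInvariant a' b' := by
  have h1 := shift_discriminant he
  have h2 : a ^ 2 - 3 * b = (3 * e + a) ^ 2 - 3 * (3 * e ^ 2 + 2 * a * e + b) := by ring
  unfold jInvariant
  rw [← h1, h2, ha, hb]
  have h3 : (u ^ 2 * b') ^ 2 * ((u * a') ^ 2 - 4 * (u ^ 2 * b')) =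
      u ^ 6 * (b' ^ 2 * (a' ^ 2 - 4 * b')) := by ring
  have h4 : 256 * ((u * a') ^ 2 - 3 * (u ^ 2 * b')) ^ 3 =
      u ^ 6 * (256 * (a' ^ 2 - 3 * b') ^ 3) := by ring
  rw [h3, h4, mul_div_mul_left _ _ (pow_ne_zero _ hu)]

/-- Moving a root of the cubic polynomial to zero. -/
lemma isConjugate_shift {a b e : ℂ} (he : e * (e ^ 2 + a * e + b) = 0) (z : OnePoint ℂ) :
    toSphere (duplication a b) (toSphere (moebius 1 e 0 1) z) =
      toSphere (moebius 1 e 0 1)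
        (toSphere (duplication (3 * e + a) (3 * e ^ 2 + 2 * a * e + b)) z) := by
  have hτ : ∀ z : ℂ, toSphere (moebius 1 e 0 1) z = ((z + e : ℂ) : OnePoint ℂ) := fun z => by
    rw [toSphere_moebius (by simp), ratio_of_ne_zero (by simp)]; simp
  have : toSphere (duplication a b) ∘ toSphere (moebius 1 e 0 1) = toSphere (moebius 1 e 0 1) ∘
      toSphere (duplication (3 * e + a) (3 * e ^ 2 + 2 * a * e + b)) := by
    refine ext_of_eventually_eq ((continuous_toSphere _).comp (continuous_toSphere _))
      ((continuous_toSphere _).comp (continuous_toSphere _)) ?_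
    filter_upwards [eventually_cubic_ne_zero (3 * e + a) (3 * e ^ 2 + 2 * a * e + b)]
      with z ⟨hz, hz'⟩
    have hc : (z + e) * ((z + e) ^ 2 + a * (z + e) + b) =
        z * (z ^ 2 + (3 * e + a) * z + (3 * e ^ 2 + 2 * a * e + b)) := by
      linear_combination he
    have hne := mul_ne_zero hz hz'
    rw [← hc] at hne
    rw [Function.comp_apply, Function.comp_apply, hτ,
      toSphere_duplication (left_ne_zero_of_mul hne) (right_ne_zero_of_mul hne),
      toSphere_duplication hz hz', hτ, OnePoint.coe_eq_coe, hc]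
    rw [div_add' _ _ _ (by simp [hz, hz'])]
    congr 1
    linear_combination (-8 * z - 8 * e - 4 * a) * he
  exact congrFun this z

/-- The point at infinity is the only value of a duplication map at points with at most two
preimages. -/
lemma Admissible.duplication_eq_infty {a b : ℂ} (h : Admissible a b) {c p q : OnePoint ℂ}
    (hpq : ∀ z, toSphere (duplication a b) z = c → z = p ∨ z = q) :
    toSphere (duplication a b) c = OnePoint.infty := by
  induction c using OnePoint.rec with
  | infty => exact toSphere_duplication_infty a b
  | coe c =>
    rw [h.toSphere_duplication, ratio_eq_infty_iff]
    by_contra hc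
    -- The roots of `P` are the finite preimages of `c`. Unless `c` is a root of the cubic there are
    -- four distinct ones, too many for `hpq`.
    set P : ℂ[X] := (X ^ 2 - C b) ^ 2 - C (4 * c) * (X * (X ^ 2 + C a * X + C b)) with hP
    have hdeg : P.natDegree = 4 := by
      rw [hP]
      compute_degree!
    have hsep : P.Separable := by
      rw [Polynomial.Separable, Polynomial.isCoprime_iff_aeval_ne_zero_of_isAlgClosed (k := ℂ) (K := ℂ)]
      intro z
      by_contra! h0
      obtain ⟨h1, h2⟩ := h0
      simp [hP, derivative_pow] at h1 h2
      have hD := h.not_both_zero z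
      set D := 4 * (z * (z ^ 2 + a * z + b)) with hDdef
      set N := (z ^ 2 - b) ^ 2 with hN
      have hND : N = c * D := by rw [hDdef]; linear_combination h1
      have hD0 : D ≠ 0 := fun h0 => hD ⟨by rw [hND, h0, mul_zero], h0⟩
      set N' := 4 * z * (z ^ 2 - b) with hN'
      set D' := 4 * (3 * z ^ 2 + 2 * a * z + b) with hD'
      have hND' : N' = c * D' := by rw [hN', hD']; linear_combination h2
      -- This identity expresses that duplication multiplies the invariant differential dx / y by 2.
      -- At a double root of `P` its right side vanishes, so `c` is a root of the cubic.
      have hW : N ^ 3 + a * N ^ 2 * D + b * N * D ^ 2 = (N' * D - N * D') ^ 2 / 16 := by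
        rw [hN, hDdef, hN', hD']; ring
      rw [hND', hND] at hW
      have : D ^ 3 * (4 * (c * (c ^ 2 + a * c + b))) = 0 := by linear_combination 4 * hW
      exact hc ((mul_eq_zero.1 this).resolve_left (pow_ne_zero _ hD0))
    have hcard : Fintype.card (P.rootSet ℂ) = 4 := by
      rw [← hdeg]
      exact card_rootSet_eq_natDegree hsep (IsAlgClosed.splits _)
    have hsub : ((fun z : ℂ => (z : OnePoint ℂ)) '' P.rootSet ℂ) ⊆ {p, q} := by
      rintro _ ⟨z, hz, rfl⟩
      apply hpq
      rw [h.toSphere_duplication, ratio_eq_coe_iff (h.not_both_zero z)]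
      have := (mem_rootSet.1 hz).2
      simp [hP] at this
      linear_combination this
    have h1 := Set.ncard_le_ncard hsub (by simp)
    rw [Set.ncard_image_of_injective _ (OnePoint.coe_injective), ← Nat.card_coe_set_eq,
      Nat.card_eq_fintype_card, hcard] at h1
    have h2 := Set.ncard_insert_le p {q}
    rw [Set.ncard_singleton] at h2
    omega

/-- Conjugate duplication maps belong to curves with the same `j`-invariant. -/
lemma Admissible.jInvariant_eq {a b a' b' : ℂ} (h : Admissible a b) (h' : Admissible a' b')
    (hc : IsConjugate (duplication a b) (duplication a' b')) :
    jInvariant a b = jInvariant a' b' := by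
  obtain ⟨f, g, hfg, hc⟩ := hc
  obtain ⟨α, β, γ, δ, hdet, rfl⟩ := hfg.eq_moebius
  -- The fibre of the second duplication over 0 consists of the square roots of `b'`, so the image
  -- of 0 under the Möbius map has at most two preimages under the first duplication, which then
  -- sends it to infinity. The second duplication sends 0 to infinity, so conjugacy makes infinity a
  -- fixed point.
  have hinf : toSphere (moebius α β γ δ) OnePoint.infty = OnePoint.infty := by
    obtain ⟨s, hs⟩ := IsAlgClosed.exists_pow_nat_eq b' (n := 2) (by norm_num)
    have hfib : ∀ z : OnePoint ℂ, toSphere (duplication a' b') z = (0 : ℂ) →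
        z = (s : ℂ) ∨ z = (-s : ℂ) := by
      intro z hz
      induction z using OnePoint.rec with
      | infty =>
        rw [toSphere_duplication_infty] at hz
        exact absurd hz (OnePoint.infty_ne_coe _)
      | coe z =>
        rw [h'.toSphere_duplication, ratio_eq_coe_iff (h'.not_both_zero z), zero_mul,
          ← hs] at hz
        have : (z - s) * (z + s) = 0 := by
          rw [← pow_eq_zero_iff two_ne_zero]
          linear_combination hz
        rcases mul_eq_zero.1 this with h1 | h1
        · exact Or.inl (by rw [sub_eq_zero.1 h1])
        · exact Or.inr (by rw [eq_neg_of_add_eq_zero_left h1])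
    have h1 := h.duplication_eq_infty (c := toSphere (moebius α β γ δ) (0 : ℂ))
      (p := toSphere (moebius α β γ δ) (s : ℂ)) (q := toSphere (moebius α β γ δ) (-s : ℂ))
      (fun z hz => by
        have h2 := hc (toSphere g z)
        rw [hfg.1, hz] at h2
        have h3 := congrArg (toSphere g) h2
        rw [hfg.2, hfg.2] at h3
        rcases hfib _ h3.symm with h4 | h4
        · left; rw [← h4, hfg.1]
        · right; rw [← h4, hfg.1])
    rw [hc, h'.toSphere_duplication] at h1
    simpa using h1
  have hγ : γ = 0 := by
    by_contra hγ
    have h1 : toSphere (moebius α β γ δ) (-δ / γ : ℂ) = OnePoint.infty := by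
      rw [toSphere_moebius hdet, ratio_eq_infty_iff]
      field_simp
      ring
    have h2 := congrArg (toSphere g) (h1.trans hinf.symm)
    rw [hfg.2, hfg.2] at h2
    exact OnePoint.coe_ne_infty _ h2
  subst hγ
  rw [mul_zero, sub_zero] at hdet
  have hα := left_ne_zero_of_mul hdet
  have hδ := right_ne_zero_of_mul hdet
  set u := α / δ with hu
  set v := β / δ with hv
  have hu0 : u ≠ 0 := div_ne_zero hα hδ
  -- The roots of the cubics are the finite points sent to infinity, and the affine map preserves
  -- this property.
  have hroot : ∀ z : ℂ, z * (z ^ 2 + a' * z + b') = 0 →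
      (u * z + v) * ((u * z + v) ^ 2 + a * (u * z + v) + b) = 0 := by
    intro z hz
    have h1 := hc z
    rw [h'.toSphere_duplication, hz, mul_zero, ratio_zero_right, hinf,
      toSphere_moebius (by simpa using hdet), zero_mul, zero_add, ratio_of_ne_zero hδ] at h1
    have h2 : (α * z + β) / δ = u * z + v := by rw [hu, hv]; ring
    rw [h2, h.toSphere_duplication, ratio_eq_infty_iff] at h1
    simpa using h1
  obtain ⟨r, s, hr, hs, hrs, ha', hb'⟩ := h'.exists_roots
  have hv0 := hroot 0 (by simp)
  have er := hroot r (by rw [ha', hb']; ring)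
  have es := hroot s (by rw [ha', hb']; ring)
  rw [mul_zero, zero_add] at hv0
  -- The first cubic at u z + v, minus u³ times the second cubic at z, is z (k₂ z + k₁) plus the
  -- value at `v`, which is 0. Vanishing at the two nonzero roots forces both coefficients to
  -- vanish.
  set k₂ := u ^ 2 * (3 * v + a - u * a') with hk₂
  set k₁ := u * (3 * v ^ 2 + 2 * a * v + b - u ^ 2 * b') with hk₁
  have er' : k₂ * r + k₁ = 0 := by
    apply mul_left_cancel₀ hr
    rw [hk₂, hk₁, ha', hb']
    linear_combination er - hv0
  have es' : k₂ * s + k₁ = 0 := by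
    apply mul_left_cancel₀ hs
    rw [hk₂, hk₁, ha', hb']
    linear_combination es - hv0
  have hk₂0 : k₂ = 0 := by
    apply mul_right_cancel₀ (sub_ne_zero.2 hrs)
    linear_combination er' - es'
  have hk₁0 : k₁ = 0 := by linear_combination er' - r * hk₂0
  refine jInvariant_eq_of_affine hu0 hv0 ?_ ?_
  · rw [hk₂] at hk₂0
    have := (mul_eq_zero.1 hk₂0).resolve_left (pow_ne_zero _ hu0)
    linear_combination this
  · rw [hk₁] at hk₁0
    have := (mul_eq_zero.1 hk₁0).resolve_left hu0
    linear_combination this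

/-! ### Decompositions of duplication maps. -/

/-- A rational function with a rational left inverse is a Möbius transformation. -/
lemma exists_inversePair_of_leftInverse {U h : RatFunc ℂ}
    (hU : ∀ w, toSphere U (toSphere h w) = w) : IsInversePair h U := by
  have hh : ¬IsConst h := by
    rintro ⟨c, hc⟩
    have h1 := hU OnePoint.infty
    have h2 := hU ((0 : ℂ) : OnePoint ℂ)
    rw [hc] at h1 h2
    exact OnePoint.coe_ne_infty (0 : ℂ) (h2.symm.trans h1)
  rcases inversePair_or_not_injective hh with ⟨h', hh'⟩ | h1
  · refine ⟨fun z => ?_, hU⟩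
    rw [← hh'.1 z, hU]
  · obtain ⟨z, w, hne, hw⟩ := (infinite_of_eventually h1).nonempty
    have := congrArg (toSphere U) hw
    rw [hU, hU, OnePoint.coe_eq_coe] at this
    exact absurd this hne

lemma eq_of_twoIsogeny_eq {k a b z w : ℂ} (hk : k ≠ 0) (hb : b ≠ 0) (hz : z ≠ 0) (hne : w ≠ z)
    (h : toSphere (twoIsogeny k a b) w = toSphere (twoIsogeny k a b) z) : w = b / z := by
  have hw : w ≠ 0 := by
    rintro rfl
    rw [toSphere_twoIsogeny_zero hk a hb, toSphere_twoIsogeny hz] at h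
    exact OnePoint.infty_ne_coe _ h
  rw [toSphere_twoIsogeny hw, toSphere_twoIsogeny hz, OnePoint.coe_eq_coe,
    div_eq_div_iff hw hz] at h
  rw [eq_div_iff hz]
  have : (k * (w - z)) * (w * z - b) = 0 := by linear_combination h
  rcases mul_eq_zero.1 this with h1 | h1
  · exact absurd h1 (mul_ne_zero hk (sub_ne_zero.2 hne))
  · exact sub_eq_zero.1 h1

/-- Exchanging the factors of a decomposition of a duplication map whose inner factor is
invariant under the translation by the point `(0, 0)`. -/
lemma Admissible.isConjugate_of_invariant {a b : ℂ} (h : Admissible a b) {B U V : RatFunc ℂ}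
    (hUV : ∀ z, toSphere (duplication a b) z = toSphere U (toSphere V z))
    (hB : ∀ z, toSphere B z = toSphere V (toSphere U z))
    (hV : {z : ℂ | z ≠ 0 ∧ toSphere V z = toSphere V (b / z : ℂ)}.Infinite) :
    IsConjugate B (duplication a b) ∨
      IsConjugate B (duplication (-2 * a) (a ^ 2 - 4 * b)) := by
  obtain ⟨g, hg⟩ := exists_comp_twoIsogeny (k := 1) (a := a) one_ne_zero h.left hV
  have hk : (1 / 4 : ℂ) ≠ 0 := by norm_num
  have hb' := h.dual.left
  -- Here `V` is `g` after the two-isogeny, which is surjective and cancels.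
  have hUg : ∀ w, toSphere U (toSphere g w) =
      toSphere (twoIsogeny (1 / 4) (-2 * a) (a ^ 2 - 4 * b)) w := by
    intro w
    obtain ⟨z, rfl⟩ := twoIsogeny_surjective (k := 1) one_ne_zero a h.left w
    rw [← toSphere_duplication_eq, hUV, hg]
  have hgc : ¬IsConst g := by
    rintro ⟨c, hc⟩
    exact twoIsogeny_not_isConst hk _ _ ⟨toSphere U c, fun z => by rw [← hUg, hc]⟩
  rcases inversePair_or_not_injective hgc with ⟨g', hg'⟩ | hg'
  · right
    refine ⟨g, g', hg', fun w => ?_⟩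
    rw [hB, hUg, hg, ← toSphere_duplication_dual_eq]
  -- Two points with the same image under `g` have the same image under the dual isogeny. So `g` is
  -- invariant under its involution and factors as `e` after that isogeny; then U ∘ e is the
  -- identity.
  · left
    have hinf : {z : ℂ | z ≠ 0 ∧
        toSphere g z = toSphere g ((a ^ 2 - 4 * b) / z : ℂ)}.Infinite := by
      refine infinite_of_eventually ?_
      filter_upwards [hg', eventually_cubic_ne_zero 0 0] with z ⟨w, hne, hw⟩ ⟨hz, _⟩
      refine ⟨hz, ?_⟩
      have := congrArg (toSphere U) hw
      rw [hUg, hUg] at this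
      rw [← eq_of_twoIsogeny_eq hk hb' hz hne this, hw]
    obtain ⟨e, he⟩ := exists_comp_twoIsogeny (a := -2 * a) hk hb' hinf
    have hUe : ∀ w, toSphere U (toSphere e w) = w := by
      intro w
      obtain ⟨z, rfl⟩ := twoIsogeny_surjective hk (-2 * a) hb' w
      rw [← he, hUg]
    have hpair := exists_inversePair_of_leftInverse hUe
    refine ⟨e, U, hpair, fun w => ?_⟩
    rw [hB, hUe, hg, he, ← toSphere_duplication_eq]

/-- An elementary transformation of a duplication map is conjugate to a duplication map of the
same curve or of a curve that is two-isogenous to it. -/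
lemma Admissible.isConjugate_of_comp {a b : ℂ} (h : Admissible a b) {B U V : RatFunc ℂ}
    (hUV : ∀ z, toSphere (duplication a b) z = toSphere U (toSphere V z))
    (hB : ∀ z, toSphere B z = toSphere V (toSphere U z)) :
    ∃ c d, Admissible c d ∧ jInvariant c d = jInvariant a b ∧
      (IsConjugate B (duplication c d) ∨
        IsConjugate B (duplication (-2 * c) (c ^ 2 - 4 * d))) := by
  have hVc : ¬IsConst V := by
    rintro ⟨c, hc⟩
    exact duplication_not_isConst a b ⟨toSphere U c, fun z => by rw [hUV, hc]⟩
  rcases inversePair_or_not_injective hVc with ⟨V', hV'⟩ | hV'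
  · exact ⟨a, b, h, rfl, Or.inl ⟨V, V', hV', fun z => by rw [hB, hUV]⟩⟩
  obtain ⟨r, s, hr, hs, hrs, ha, hb⟩ := h.exists_roots
  have hinf := infinite_of_eventually (hV'.and (eventually_cubic_ne_zero a b))
  -- The equation (z - e)(w - e) = 3e² + 2ae + b says that `w` arises from `z` by translation by the
  -- point (e, 0) of order two. The infinitely many generic `z` are distributed over three roots
  -- `e`.
  have hpigeon : ∃ e, e * (e ^ 2 + a * e + b) = 0 ∧ {z : ℂ | z ≠ e ∧ ∃ w : ℂ,
      (z - e) * (w - e) = 3 * e ^ 2 + 2 * a * e + b ∧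
        toSphere V w = toSphere V z}.Infinite := by
    by_contra! hfin
    apply hinf
    refine (((hfin 0 (by simp)).union
      (hfin r (by rw [ha, hb]; ring))).union
      (hfin s (by rw [ha, hb]; ring))).subset ?_
    rintro z ⟨⟨w, hne, hw⟩, hz, hz'⟩
    have hzr : z ≠ r := by rintro rfl; apply hz'; rw [ha, hb]; ring
    have hzs : z ≠ s := by rintro rfl; apply hz'; rw [ha, hb]; ring
    have h1 := congrArg (toSphere U) hw
    rw [← hUV, ← hUV, h.toSphere_duplication, h.toSphere_duplication] at h1
    have h2 := mul_eq_mul_of_ratio_eq_ratio h1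
    -- Equality of the two duplication values factors into the trivial solution and the three
    -- translations by points of order two.
    have h3 : (w - z) * ((z * w - r * s) * (((z - r) * (w - r) - r * (r - s)) *
        ((z - s) * (w - s) - s * (s - r)))) = 0 := by
      rw [ha, hb] at h2
      linear_combination h2 / 4
    rw [ha, hb]
    rcases mul_eq_zero.1 h3 with h4 | h4
    · exact absurd h4 (sub_ne_zero.2 hne)
    rcases mul_eq_zero.1 h4 with h5 | h5
    · exact Or.inl (Or.inl ⟨hz, w, by linear_combination h5, hw⟩)
    rcases mul_eq_zero.1 h5 with h6 | h6
    · exact Or.inl (Or.inr ⟨hzr, w, by linear_combination h6, hw⟩)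
    · exact Or.inr ⟨hzs, w, by linear_combination h6, hw⟩
  obtain ⟨e, he, hinf⟩ := hpigeon
  have had : Admissible (3 * e + a) (3 * e ^ 2 + 2 * a * e + b) := by
    unfold Admissible
    rw [shift_discriminant he]
    exact h
  have hτ : IsInversePair (moebius 1 e 0 1) (moebius 1 (-e) (-0) 1) :=
    isInversePair_moebius (by simp)
  have hτ' : ∀ z : ℂ, toSphere (moebius 1 e 0 1) z = ((z + e : ℂ) : OnePoint ℂ) := fun z => by
    rw [toSphere_moebius (by simp), ratio_of_ne_zero (by simp)]; simp
  have hUc : ¬IsConst U := by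
    rintro ⟨c, hc⟩
    exact duplication_not_isConst a b ⟨c, fun z => by rw [hUV, hc]⟩
  obtain ⟨V₁, hV₁⟩ := exists_comp V hτ.not_isConst
  obtain ⟨U₁, hU₁⟩ := exists_comp (moebius 1 (-e) (-0) 1) hUc
  refine ⟨_, _, had, (jInvariant_eq_of_affine one_ne_zero he (by ring) (by ring)).symm,
    had.isConjugate_of_invariant (U := U₁) (V := V₁) (fun z => ?_) (fun z => ?_) ?_⟩
  · rw [hU₁, hV₁, Function.comp_apply, Function.comp_apply, ← hUV, isConjugate_shift he, hτ.2]
  · rw [hU₁, hV₁, Function.comp_apply, Function.comp_apply, hτ.1, hB]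
  · refine Set.Infinite.mono ?_ (hinf.image (sub_left_injective (b := e)).injOn)
    rintro _ ⟨z, ⟨hz, w, hzw, hw⟩, rfl⟩
    have hne : z - e ≠ 0 := sub_ne_zero.2 hz
    refine ⟨hne, ?_⟩
    rw [hV₁, Function.comp_apply, Function.comp_apply, hτ', hτ', sub_add_cancel, ← hzw,
      mul_div_cancel_left₀ _ hne, sub_add_cancel, hw]

/-- The conjugation is absorbed into the factors: g ∘ A ∘ f = (g ∘ U) ∘ (V ∘ f), and exchanging
these factors still gives V ∘ U because `f` and `g` cancel. -/
lemma Admissible.isConjugate_of_isElementaryTransformation {a b : ℂ} (h : Admissible a b)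
    {A B : RatFunc ℂ} (hA : IsConjugate A (duplication a b))
    (hAB : IsElementaryTransformation A B) :
    ∃ c d, Admissible c d ∧ jInvariant c d = jInvariant a b ∧
      (IsConjugate B (duplication c d) ∨
        IsConjugate B (duplication (-2 * c) (c ^ 2 - 4 * d))) := by
  obtain ⟨f, g, hfg, hA⟩ := hA
  obtain ⟨U, V, hUV, hVU⟩ := hAB
  have hUV' : ∀ z, toSphere A z = toSphere U (toSphere V z) := congrFun hUV
  have hL : ∀ z, toSphere (duplication a b) z =
      toSphere g (toSphere U (toSphere V (toSphere f z))) := fun z => by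
    rw [← hUV', hA, hfg.2]
  have hUc : ¬IsConst U := by
    rintro ⟨c, hc⟩
    exact duplication_not_isConst a b ⟨toSphere g c, fun z => by rw [hL, hc]⟩
  obtain ⟨V₁, hV₁⟩ := exists_comp V hfg.not_isConst
  obtain ⟨U₁, hU₁⟩ := exists_comp g hUc
  refine h.isConjugate_of_comp (U := U₁) (V := V₁) (fun z => ?_) (fun z => ?_)
  · rw [hL, hU₁, hV₁]; rfl
  · rw [hU₁, hV₁, Function.comp_apply, Function.comp_apply, hfg.1]
    exact congrFun hVU z

/-! ### From Lattès maps on Weierstrass curves to duplication maps. -/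

open WeierstrassCurve

section Doubling

/-- The numerator of the duplication map of a Weierstrass curve on `x`-coordinates. -/
noncomputable def doublingNum (W : WeierstrassCurve ℂ) : ℂ[X] :=
  X ^ 4 - C W.b₄ * X ^ 2 - C (2 * W.b₆) * X - C W.b₈

/-- The denominator of the duplication map of a Weierstrass curve on `x`-coordinates. -/
noncomputable def doublingDenom (W : WeierstrassCurve ℂ) : ℂ[X] :=
  C 4 * X ^ 3 + C W.b₂ * X ^ 2 + C (2 * W.b₄) * X + C W.b₆

/-- The duplication map of a Weierstrass curve on `x`-coordinates. -/
noncomputable def doubling (W : WeierstrassCurve ℂ) : RatFunc ℂ :=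
  frac (doublingNum W) (doublingDenom W)

variable (W : WeierstrassCurve ℂ)

lemma eval_doublingNum (x : ℂ) : (doublingNum W).eval x =
    x ^ 4 - W.b₄ * x ^ 2 - 2 * W.b₆ * x - W.b₈ := by
  simp [doublingNum]

lemma eval_doublingDenom (x : ℂ) : (doublingDenom W).eval x =
    4 * x ^ 3 + W.b₂ * x ^ 2 + 2 * W.b₄ * x + W.b₆ := by
  simp [doublingDenom]

lemma natDegree_doublingDenom : (doublingDenom W).natDegree = 3 := by
  unfold doublingDenom; compute_degree!

lemma doublingDenom_ne_zero : doublingDenom W ≠ 0 := by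
  intro h
  have := natDegree_doublingDenom W
  simp [h] at this

lemma toSphere_doubling_infty : toSphere (doubling W) OnePoint.infty = OnePoint.infty := by
  refine toSphere_frac_infty (doublingDenom_ne_zero W) ?_
  rw [natDegree_doublingDenom]
  have : (doublingNum W).natDegree = 4 := by unfold doublingNum; compute_degree!
  omega

lemma doubling_not_isConst : ¬IsConst (doubling W) := by
  obtain ⟨z, hz⟩ :=
    (infinite_of_eventually (eventually_eval_ne_zero (doublingDenom_ne_zero W))).nonempty
  refine not_isConst_of_ne (z := OnePoint.infty) (w := z) ?_
  rw [toSphere_doubling_infty, doubling, toSphere_frac hz]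
  exact OnePoint.infty_ne_coe _

variable {W}

/-- Completing the square: η = 2y + a₁x + a₃ changes sign under negation of points, and its square
depends on `x` alone. -/
lemma sq_eq_eval_doublingDenom {x y : ℂ} (h : W.toAffine.Equation x y) :
    (2 * y + W.a₁ * x + W.a₃) ^ 2 = (doublingDenom W).eval x := by
  rw [Affine.equation_iff] at h
  rw [eval_doublingDenom, WeierstrassCurve.b₂, WeierstrassCurve.b₄, WeierstrassCurve.b₆]
  linear_combination 4 * h

lemma sub_negY (x y : ℂ) : y - W.toAffine.negY x y = 2 * y + W.a₁ * x + W.a₃ := by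
  rw [Affine.negY]; ring

lemma ne_negY_iff {x y : ℂ} (h : W.toAffine.Equation x y) :
    y ≠ W.toAffine.negY x y ↔ (doublingDenom W).eval x ≠ 0 := by
  rw [← sq_eq_eval_doublingDenom h, ← sub_negY, ← sub_ne_zero]
  simp

/-- The duplication formula on `x`-coordinates. -/
lemma exists_two_nsmul_eq {x y : ℂ} (h : W.toAffine.Nonsingular x y)
    (hx : (doublingDenom W).eval x ≠ 0) :
    ∃ y' h', (2 : ℕ) • Affine.Point.some x y h =
      Affine.Point.some ((doublingNum W).eval x / (doublingDenom W).eval x) y' h' := by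
  have hy := (ne_negY_iff h.1).2 hx
  have hη : 2 * y + W.a₁ * x + W.a₃ ≠ 0 := by rw [← sub_negY]; exact sub_ne_zero.2 hy
  have key : W.toAffine.addX x x (W.toAffine.slope x x y y) =
      (doublingNum W).eval x / (doublingDenom W).eval x := by
    rw [Affine.slope_of_Y_ne rfl hy, sub_negY, Affine.addX, eq_div_iff hx,
      ← sq_eq_eval_doublingDenom h.1, eval_doublingNum]
    have heq := h.1
    rw [Affine.equation_iff] at heq
    rw [WeierstrassCurve.b₄, WeierstrassCurve.b₆, WeierstrassCurve.b₈]
    have hdiv : ∀ n η : ℂ, η ≠ 0 → ((n / η) ^ 2 + W.a₁ * (n / η) - W.a₂ - x - x) * η ^ 2 =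
        n ^ 2 + W.a₁ * n * η - (W.a₂ + 2 * x) * η ^ 2 := fun n η hη => by
      field_simp
      ring
    rw [hdiv _ _ hη]
    linear_combination (-8 * x - 4 * W.a₂ - W.a₁ ^ 2) * heq
  refine ⟨W.toAffine.addY x x y (W.toAffine.slope x x y y), ?_, ?_⟩
  · rw [← key]
    exact Affine.nonsingular_add h h (fun hxy => hy hxy.2)
  · rw [two_nsmul, Affine.Point.add_self_of_Y_ne hy]
    simp only [key]

lemma exists_equation (x : ℂ) : ∃ y, W.toAffine.Equation x y := by
  obtain ⟨y, hy⟩ := exists_quadratic_root (W.a₁ * x + W.a₃)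
    (-(x ^ 3 + W.a₂ * x ^ 2 + W.a₄ * x + W.a₆))
  refine ⟨y, ?_⟩
  rw [Affine.equation_iff]
  linear_combination hy

lemma exists_nonsingular [W.IsElliptic] (x : ℂ) : ∃ y, W.toAffine.Nonsingular x y := by
  obtain ⟨y, hy⟩ := exists_equation (W := W) x
  exact ⟨y, Affine.equation_iff_nonsingular.1 hy⟩

variable (W) in
-- On the affine curve, 1 and η = 2y + a₁x + a₃ span the coordinate ring over ℂ[x].
lemma exists_eval_eq_add_mul_of_equation (F : MvPolynomial (Fin 3) ℂ) :
    ∃ A B : ℂ[X], ∀ x y, W.toAffine.Equation x y → MvPolynomial.eval ![x, y, 1] F =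
      A.eval x + (2 * y + W.a₁ * x + W.a₃) * B.eval x := by
  induction F using MvPolynomial.induction_on with
  | C c => exact ⟨C c, 0, fun x y _ => by simp⟩
  | add p q hp hq =>
    obtain ⟨A, B, h⟩ := hp
    obtain ⟨A', B', h'⟩ := hq
    refine ⟨A + A', B + B', fun x y hxy => ?_⟩
    rw [map_add, h x y hxy, h' x y hxy, eval_add, eval_add]
    ring
  | mul_X p i hp =>
    obtain ⟨A, B, h⟩ := hp
    fin_cases i
    · refine ⟨X * A, X * B, fun x y hxy => ?_⟩
      simp only [map_mul, h x y hxy, eval_mul, eval_X, MvPolynomial.eval_X]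
      simp
      ring
    · refine ⟨C (1 / 2) * (doublingDenom W * B - (C W.a₁ * X + C W.a₃) * A),
        C (1 / 2) * (A - (C W.a₁ * X + C W.a₃) * B), fun x y hxy => ?_⟩
      simp only [map_mul, h x y hxy, eval_mul, eval_X, MvPolynomial.eval_X, eval_sub, eval_add,
        eval_C, ← sq_eq_eval_doublingDenom hxy]
      simp
      ring
    · refine ⟨A, B, fun x y hxy => ?_⟩
      simp only [map_mul, h x y hxy, MvPolynomial.eval_X]
      simp

/-- This is the norm of A + η B. It cannot vanish by parity of degrees, η² being a cubic in `x`. -/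
lemma sq_sub_ne_zero {A B : ℂ[X]} (h : ¬(A = 0 ∧ B = 0)) :
    A ^ 2 - doublingDenom W * B ^ 2 ≠ 0 := by
  intro h0
  have h1 : A ^ 2 = doublingDenom W * B ^ 2 := sub_eq_zero.1 h0
  by_cases hB : B = 0
  · exact h ⟨by simpa [hB] using h1, hB⟩
  · have := congrArg natDegree h1
    rw [natDegree_mul (doublingDenom_ne_zero W) (pow_ne_zero _ hB), natDegree_pow, natDegree_pow,
      natDegree_doublingDenom] at this
    omega

/-- An even morphism from an elliptic curve to the sphere is, away from finitely many
`x`-coordinates, infinite or a rational function of the `x`-coordinate. -/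
lemma IsMorphism.exists_ratFunc [W.IsElliptic] {π : W.toAffine.Point → OnePoint ℂ}
    (hπ : IsMorphism π) (heven : ∀ P, π (-P) = π P) :
    (∀ᶠ x in cofinite, ∀ y h, π (.some x y h) = OnePoint.infty) ∨
      ∃ g : RatFunc ℂ, ∀ᶠ x : ℂ in cofinite, ∀ y h, π (.some x y h) = toSphere g x := by
  obtain ⟨y₀, h₀⟩ := exists_nonsingular (W := W) 0
  obtain ⟨n, F, G, -, -, hne, hFG⟩ := hπ (.some 0 y₀ h₀)
  obtain ⟨A, B, hAB⟩ := exists_eval_eq_add_mul_of_equation W F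
  obtain ⟨A', B', hAB'⟩ := exists_eval_eq_add_mul_of_equation W G
  have hF : ∀ x y h, MvPolynomial.eval (coords (W := W) (.some x y h)) F =
      A.eval x + (2 * y + W.a₁ * x + W.a₃) * B.eval x := fun x y h => hAB x y h.1
  have hG : ∀ x y h, MvPolynomial.eval (coords (W := W) (.some x y h)) G =
      A'.eval x + (2 * y + W.a₁ * x + W.a₃) * B'.eval x := fun x y h => hAB' x y h.1
  by_cases hG0 : A' = 0 ∧ B' = 0
  · left
    have hF0 : ¬(A = 0 ∧ B = 0) := fun h => hne
      ⟨by rw [hF, h.1, h.2]; simp, by rw [hG, hG0.1, hG0.2]; simp⟩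
    filter_upwards [eventually_eval_ne_zero (sq_sub_ne_zero (W := W) hF0)] with x hx y h
    rw [hFG, hG, hG0.1, hG0.2]
    · simp
    · rintro ⟨h1, -⟩
      rw [hF] at h1
      apply hx
      simp only [eval_sub, eval_mul, eval_pow, ← sq_eq_eval_doublingDenom h.1]
      linear_combination (A.eval x - (2 * y + W.a₁ * x + W.a₃) * B.eval x) * h1
  · right
    -- Multiplying numerator and denominator by A' - η B' makes the denominator the norm `D`;
    -- evenness of `π` removes the part of the numerator that is odd in η.
    set D : ℂ[X] := A' ^ 2 - doublingDenom W * B' ^ 2 with hD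
    refine ⟨frac (A * A' - doublingDenom W * (B * B')) D, ?_⟩
    filter_upwards [eventually_eval_ne_zero (sq_sub_ne_zero (W := W) hG0)] with x hx y h
    rw [← hD] at hx
    have hD' : ∀ y h', D.eval x = MvPolynomial.eval (coords (W := W) (.some x y h')) G *
        (A'.eval x - (2 * y + W.a₁ * x + W.a₃) * B'.eval x) := fun y h' => by
      rw [hG]
      simp only [hD, eval_sub, eval_mul, eval_pow, ← sq_eq_eval_doublingDenom h'.1]
      ring
    have hval : ∀ y h', MvPolynomial.eval (coords (W := W) (.some x y h')) G ≠ 0 ∧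
        π (.some x y h') = ((MvPolynomial.eval (coords (W := W) (.some x y h')) F /
          MvPolynomial.eval (coords (W := W) (.some x y h')) G : ℂ) : OnePoint ℂ) :=
      fun y h' => by
        have hG1 : MvPolynomial.eval (coords (W := W) (.some x y h')) G ≠ 0 := by
          intro h0
          rw [hD' y h', h0, zero_mul] at hx
          exact hx rfl
        exact ⟨hG1, by rw [hFG _ fun h => hG1 h.2, ratio_of_ne_zero hG1]⟩
    have hn := (Affine.nonsingular_neg x y).2 h
    obtain ⟨hd, hv⟩ := hval y h
    obtain ⟨hd', hv'⟩ := hval _ hn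
    have heq := heven (.some x y h)
    rw [Affine.Point.neg_some, hv, hv', OnePoint.coe_eq_coe, div_eq_div_iff hd' hd] at heq
    rw [hv, toSphere_frac hx, OnePoint.coe_eq_coe, div_eq_div_iff hd hx, hD' y h]
    have hneg : 2 * W.toAffine.negY x y + W.a₁ * x + W.a₃ = -(2 * y + W.a₁ * x + W.a₃) := by
      rw [Affine.negY]; ring
    rw [hF, hF, hG, hG, hneg] at heq
    rw [hF, hG]
    simp only [eval_sub, eval_mul, ← sq_eq_eval_doublingDenom h.1]
    linear_combination (-(1 / 2 : ℂ)) * (A'.eval x + (2 * y + W.a₁ * x + W.a₃) * B'.eval x) * heq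

/-- Almost all points have an `x`-coordinate with a given property of almost all numbers. -/
lemma finite_points {Q : ℂ → Prop} (hQ : ∀ᶠ x in cofinite, Q x) :
    {P : W.toAffine.Point | ¬∃ x y h, P = .some x y h ∧ Q x}.Finite := by
  have hx : ∀ x, {P : W.toAffine.Point | ∃ y h, P = .some x y h}.Finite := by
    intro x
    by_cases hne : {P : W.toAffine.Point | ∃ y h, P = .some x y h}.Nonempty
    · obtain ⟨P, y, h, rfl⟩ := hne
      refine (Set.toFinite {Affine.Point.some x y h, -Affine.Point.some x y h}).subset ?_
      rintro _ ⟨y', h', rfl⟩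
      exact Affine.Point.X_eq_iff.1 rfl
    · rw [Set.not_nonempty_iff_eq_empty.1 hne]
      exact Set.finite_empty
  refine ((Set.finite_singleton 0).union ((Filter.eventually_cofinite.1 hQ).biUnion
    fun x _ => hx x)).subset ?_
  rintro (_ | ⟨x, y, h⟩) hP
  · exact Or.inl rfl
  · refine Or.inr (Set.mem_biUnion (x := x) (fun hQx => hP ⟨x, y, h, rfl, hQx⟩) ⟨y, h, rfl⟩)

/-- Otherwise `π` would have finitely many values and almost all fibres would be empty. -/
lemma HasDegree.not_eventually_const {π : W.toAffine.Point → OnePoint ℂ} (hdeg : HasDegree π 2)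
    {c : OnePoint ℂ} : ¬∀ᶠ x in cofinite, ∀ y h, π (.some x y h) = c := by
  intro hc
  have hfin := ((finite_points hc).image π).union (Set.finite_singleton c)
  have h1 : ∀ᶠ t in cofinite,
      t ∉ π '' {P : W.toAffine.Point | ¬∃ x y h, P = .some x y h ∧
        ∀ y h, π (.some x y h) = c} ∪ {c} := hfin.compl_mem_cofinite
  obtain ⟨t, ht, ht2⟩ := (h1.and hdeg).exists
  have : π ⁻¹' {t} = ∅ := by
    ext P
    simp only [Set.mem_preimage, Set.mem_singleton_iff, Set.mem_empty_iff_false, iff_false]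
    rintro rfl
    by_cases hP : ∃ x y h, P = .some x y h ∧ ∀ y h, π (.some x y h) = c
    · obtain ⟨x, y, h, rfl, hx⟩ := hP
      exact ht (Or.inr (hx y h))
    · exact ht (Or.inl ⟨P, hP, rfl⟩)
  simp [this] at ht2

/-- The `x`-coordinate has degree two already. If `g` took a generic value at both `z` and `w`, the
fibre of `π` would contain two points above `z` and another above `w`. -/
lemma IsMorphism.exists_inversePair [W.IsElliptic] {π : W.toAffine.Point → OnePoint ℂ}
    (hπ : IsMorphism π) (hdeg : HasDegree π 2) (heven : ∀ P, π (-P) = π P) :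
    ∃ g g' : RatFunc ℂ, IsInversePair g g' ∧
      ∀ᶠ x : ℂ in cofinite, ∀ y h, π (.some x y h) = toSphere g x := by
  rcases hπ.exists_ratFunc heven with h | ⟨g, hg⟩
  · exact absurd h hdeg.not_eventually_const
  have hgc : ¬IsConst g := by
    rintro ⟨c, hc⟩
    refine hdeg.not_eventually_const (c := c) ?_
    filter_upwards [hg] with x hx y h
    rw [hx, hc]
  rcases inversePair_or_not_injective hgc with ⟨g', hg'⟩ | hinj
  · exact ⟨g, g', hg', hg⟩
  exfalso
  have h1 : ∀ᶠ z : ℂ in cofinite, ∀ t ∈ {t | ¬(π ⁻¹' {t}).ncard = 2}, toSphere g z ≠ t :=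
    (Set.Finite.eventually_all (Filter.eventually_cofinite.1 hdeg)).2 fun t _ =>
      eventually_ne_of_not_isConst hgc t
  have h2 : ∀ᶠ z : ℂ in cofinite, ∀ x ∈ {x : ℂ | ¬∀ y h, π (.some x y h) = toSphere g x},
      toSphere g z ≠ toSphere g x :=
    (Set.Finite.eventually_all (Filter.eventually_cofinite.1 hg)).2 fun x _ =>
      eventually_ne_of_not_isConst hgc _
  obtain ⟨z, h1, h2, h3, ⟨w, hne, hw⟩, hD⟩ := (infinite_of_eventually (h1.and (h2.and
    (hg.and (hinj.and (eventually_eval_ne_zero (doublingDenom_ne_zero W))))))).nonempty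
  have hcard : (π ⁻¹' {toSphere g z}).ncard = 2 := by
    by_contra h
    exact h1 _ h rfl
  have h4 : ∀ y h, π (.some w y h) = toSphere g w := by
    by_contra h
    exact h2 _ h hw.symm
  obtain ⟨y, hy⟩ := exists_nonsingular (W := W) z
  obtain ⟨v, hv⟩ := exists_nonsingular (W := W) w
  have hy' := (Affine.nonsingular_neg z y).2 hy
  have hsub : {Affine.Point.some z y hy, Affine.Point.some z _ hy', Affine.Point.some w v hv} ⊆
      π ⁻¹' {toSphere g z} := by
    rintro _ (rfl | rfl | rfl)
    · exact h3 _ _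
    · exact h3 _ _
    · exact (h4 _ _).trans hw
  have hle := Set.ncard_le_ncard hsub (Set.finite_of_ncard_ne_zero (by omega))
  have hyy := (ne_negY_iff hy.1).2 hD
  rw [hcard, Set.ncard_eq_three.2 ⟨_, _, _, by simpa using hyy, by simp [hne.symm],
    by simp [hne.symm], rfl⟩] at hle
  omega

/-- A Lattès map is conjugate to the duplication map on `x`-coordinates. -/
lemma IsLattes.exists_isConjugate {j : ℂ} {A : RatFunc ℂ} (hA : IsLattes j A) :
    ∃ (W : WeierstrassCurve ℂ) (_ : W.IsElliptic), W.j = j ∧ IsConjugate A (doubling W) := by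
  obtain ⟨W, hW, π, hj, hπ, hdeg, heven, hA⟩ := hA
  obtain ⟨g, g', hg, hπg⟩ := hπ.exists_inversePair hdeg heven
  refine ⟨W, hW, hj, g, g', hg, fun z => ?_⟩
  have : toSphere A ∘ toSphere g = toSphere g ∘ toSphere (doubling W) := by
    refine ext_of_eventually_eq ((continuous_toSphere _).comp (continuous_toSphere _))
      ((continuous_toSphere _).comp (continuous_toSphere _)) ?_
    filter_upwards [hπg, eventually_comp (doubling_not_isConst W) hπg,
      eventually_eval_ne_zero (doublingDenom_ne_zero W)] with x hx ⟨w, hw, hw'⟩ hD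
    obtain ⟨y, hy⟩ := exists_nonsingular (W := W) x
    obtain ⟨y', h', h2⟩ := exists_two_nsmul_eq hy hD
    have h3 := hA (.some x y hy)
    rw [doubling, toSphere_frac hD, OnePoint.coe_eq_coe] at hw
    subst hw
    rw [h2, hx, hw'] at h3
    rw [Function.comp_apply, Function.comp_apply, h3, doubling, toSphere_frac hD]
  exact congrFun this z

/-- The change of variables acts on `x`-coordinates by x ↦ u² x + r; the transformation laws of b₂,
b₄, b₆, b₈ show that this intertwines the duplication maps. -/
lemma isConjugate_variableChange (D : VariableChange ℂ) :
    IsConjugate (doubling W) (doubling (D • W)) := by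
  have hu : (D.u : ℂ) ≠ 0 := D.u.ne_zero
  have hdet : (D.u : ℂ) ^ 2 * 1 - D.r * 0 ≠ 0 := by simp
  have hτ : ∀ z : ℂ, toSphere (moebius ((D.u : ℂ) ^ 2) D.r 0 1) z =
      (((D.u : ℂ) ^ 2 * z + D.r : ℂ) : OnePoint ℂ) := fun z => by
    rw [toSphere_moebius hdet, ratio_of_ne_zero (by simp)]; simp
  refine ⟨_, _, isInversePair_moebius hdet, fun z => ?_⟩
  have : toSphere (doubling W) ∘ toSphere (moebius ((D.u : ℂ) ^ 2) D.r 0 1) =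
      toSphere (moebius ((D.u : ℂ) ^ 2) D.r 0 1) ∘ toSphere (doubling (D • W)) := by
    refine ext_of_eventually_eq ((continuous_toSphere _).comp (continuous_toSphere _))
      ((continuous_toSphere _).comp (continuous_toSphere _)) ?_
    filter_upwards [eventually_eval_ne_zero (doublingDenom_ne_zero (D • W))] with x hx
    have hb₂ : (D.u : ℂ) ^ 2 * (D • W).b₂ = W.b₂ + 12 * D.r := by
      rw [variableChange_b₂, Units.val_inv_eq_inv_val]; field_simp
    have hb₄ : (D.u : ℂ) ^ 4 * (D • W).b₄ = W.b₄ + D.r * W.b₂ + 6 * D.r ^ 2 := by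
      rw [variableChange_b₄, Units.val_inv_eq_inv_val]; field_simp
    have hb₆ : (D.u : ℂ) ^ 6 * (D • W).b₆ =
        W.b₆ + 2 * D.r * W.b₄ + D.r ^ 2 * W.b₂ + 4 * D.r ^ 3 := by
      rw [variableChange_b₆, Units.val_inv_eq_inv_val]; field_simp
    have hb₈ : (D.u : ℂ) ^ 8 * (D • W).b₈ = W.b₈ + 3 * D.r * W.b₆ + 3 * D.r ^ 2 * W.b₄ +
        D.r ^ 3 * W.b₂ + 3 * D.r ^ 4 := by
      rw [variableChange_b₈, Units.val_inv_eq_inv_val]; field_simp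
    have hden : (doublingDenom W).eval ((D.u : ℂ) ^ 2 * x + D.r) =
        (D.u : ℂ) ^ 6 * (doublingDenom (D • W)).eval x := by
      rw [eval_doublingDenom, eval_doublingDenom]
      linear_combination (-(D.u : ℂ) ^ 4 * x ^ 2) * hb₂ - 2 * (D.u : ℂ) ^ 2 * x * hb₄ - hb₆
    have hnum : (doublingNum W).eval ((D.u : ℂ) ^ 2 * x + D.r) =
        (D.u : ℂ) ^ 8 * (doublingNum (D • W)).eval x +
          D.r * (doublingDenom W).eval ((D.u : ℂ) ^ 2 * x + D.r) := by
      rw [eval_doublingDenom, eval_doublingNum, eval_doublingNum]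
      linear_combination (D.u : ℂ) ^ 4 * x ^ 2 * hb₄ + 2 * (D.u : ℂ) ^ 2 * x * hb₆ + hb₈
    have hden0 : (doublingDenom W).eval ((D.u : ℂ) ^ 2 * x + D.r) ≠ 0 := by
      rw [hden]; exact mul_ne_zero (pow_ne_zero _ hu) hx
    rw [Function.comp_apply, Function.comp_apply, hτ, doubling, doubling, toSphere_frac hden0,
      toSphere_frac hx, hτ, hnum, OnePoint.coe_eq_coe, add_div, mul_div_cancel_right₀ _ hden0,
      hden]
    congr 1
    field_simp
  exact congrFun this z

/-- The curve `y² = x (x² + a x + b)`. -/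
def modelCurve (a b : ℂ) : WeierstrassCurve ℂ := ⟨0, a, 0, b, 0⟩

lemma doublingDenom_modelCurve (a b : ℂ) :
    doublingDenom (modelCurve a b) = C 4 * (X * (X ^ 2 + C a * X + C b)) := by
  refine Polynomial.funext fun x => ?_
  rw [eval_doublingDenom]
  simp [modelCurve, WeierstrassCurve.b₂, WeierstrassCurve.b₄, WeierstrassCurve.b₆]
  ring

lemma doublingNum_modelCurve (a b : ℂ) :
    doublingNum (modelCurve a b) = (X ^ 2 - C b) ^ 2 := by
  refine Polynomial.funext fun x => ?_
  rw [eval_doublingNum]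
  simp [modelCurve, WeierstrassCurve.b₄, WeierstrassCurve.b₆, WeierstrassCurve.b₈]
  ring

lemma doubling_modelCurve (a b : ℂ) : doubling (modelCurve a b) = duplication a b := by
  rw [doubling, duplication, doublingNum_modelCurve, doublingDenom_modelCurve]

lemma modelCurve_Δ (a b : ℂ) : (modelCurve a b).Δ = 16 * (b ^ 2 * (a ^ 2 - 4 * b)) := by
  simp [modelCurve, WeierstrassCurve.Δ, WeierstrassCurve.b₂, WeierstrassCurve.b₄,
    WeierstrassCurve.b₆, WeierstrassCurve.b₈]
  ring

lemma Admissible.isElliptic {a b : ℂ} (h : Admissible a b) : (modelCurve a b).IsElliptic := by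
  refine ⟨?_⟩
  rw [modelCurve_Δ, isUnit_iff_ne_zero]
  exact mul_ne_zero (by norm_num) h

lemma modelCurve_j (a b : ℂ) [(modelCurve a b).IsElliptic] :
    (modelCurve a b).j = jInvariant a b := by
  rw [WeierstrassCurve.j, jInvariant, Units.val_inv_eq_inv_val, coe_Δ', modelCurve_Δ]
  have : (modelCurve a b).c₄ = 16 * (a ^ 2 - 3 * b) := by
    simp [modelCurve, WeierstrassCurve.c₄, WeierstrassCurve.b₂, WeierstrassCurve.b₄]
    ring
  rw [this, inv_mul_eq_div]
  have h3 : (16 * (a ^ 2 - 3 * b)) ^ 3 = 16 * (256 * (a ^ 2 - 3 * b) ^ 3) := by ring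
  rw [h3, mul_div_mul_left _ _ (by norm_num)]

/-- Over ℂ, curves with equal j-invariant differ by a change of variables, so any model with this
j-invariant may be used. -/
lemma IsLattes.isConjugate {a b : ℂ} (h : Admissible a b) {A : RatFunc ℂ}
    (hA : IsLattes (jInvariant a b) A) : IsConjugate A (duplication a b) := by
  obtain ⟨W, hW, hj, hc⟩ := hA.exists_isConjugate
  have := h.isElliptic
  rw [← modelCurve_j] at hj
  obtain ⟨D, hD⟩ := exists_variableChange_of_j_eq W (modelCurve a b) hj
  rw [← doubling_modelCurve, ← hD]
  exact hc.trans (isConjugate_variableChange D)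

end Doubling

/-! ### From conjugates of duplication maps back to Lattès maps. -/

lemma toSphere_moebius_infty {α β γ δ : ℂ} (h : α * δ - β * γ ≠ 0) :
    toSphere (moebius α β γ δ) OnePoint.infty = ratio α γ := by
  by_cases hγ : γ = 0
  · subst hγ
    rw [mul_zero, sub_zero] at h
    rw [ratio_zero_right]
    refine toSphere_frac_infty (moebius_denom_ne_zero (β := β) (by simpa using h)) ?_
    rw [natDegree_linear (left_ne_zero_of_mul h)]
    simp
  · have h1 : toSphere (moebius δ (-β) (-γ) α) (α / γ : ℂ) = OnePoint.infty := by
      rw [toSphere_moebius (by convert h using 1; ring), ratio_eq_infty_iff]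
      field_simp
      ring
    rw [← h1, (isInversePair_moebius h).1, ratio_of_ne_zero hγ]

/-- The `x`-coordinate of a point of a Weierstrass curve, as a point of the sphere. -/
def xCoord {W : WeierstrassCurve ℂ} : W.toAffine.Point → OnePoint ℂ
  | .zero => OnePoint.infty
  | .some x _ _ => (x : OnePoint ℂ)

lemma isMorphism_moebius_xCoord (a b : ℂ) {α β γ δ : ℂ} (h : α * δ - β * γ ≠ 0) :
    IsMorphism fun P : (modelCurve a b).toAffine.Point =>
      toSphere (moebius α β γ δ) (xCoord P) := by
  have hX : ∀ i : Fin 3, (MvPolynomial.X i : MvPolynomial (Fin 3) ℂ).IsHomogeneous 1 :=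
    MvPolynomial.isHomogeneous_X ℂ
  have hC : ∀ (c : ℂ) {p : MvPolynomial (Fin 3) ℂ} {n : ℕ}, p.IsHomogeneous n →
      (MvPolynomial.C c * p).IsHomogeneous n := fun c p n hp => by
    simpa using (MvPolynomial.isHomogeneous_C (Fin 3) c).mul hp
  have hindep : ∀ {u v : ℂ}, α * u + β * v = 0 → γ * u + δ * v = 0 → u = 0 ∧ v = 0 := by
    intro u v h1 h2
    have hu : (α * δ - β * γ) * u = 0 := by linear_combination δ * h1 - β * h2
    have hv : (α * δ - β * γ) * v = 0 := by linear_combination α * h2 - γ * h1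
    exact ⟨(mul_eq_zero.1 hu).resolve_left h, (mul_eq_zero.1 hv).resolve_left h⟩
  rintro (_ | ⟨x, y, hP⟩)
  -- The coordinates [X : Z] both vanish at the point at infinity [0 : 1 : 0]. The curve equation
  -- gives the alternative [Y² : X² + aXZ + bZ²], which is defined there.
  · set S : MvPolynomial (Fin 3) ℂ := MvPolynomial.X 0 * MvPolynomial.X 0 +
      MvPolynomial.C a * (MvPolynomial.X 0 * MvPolynomial.X 2) +
      MvPolynomial.C b * (MvPolynomial.X 2 * MvPolynomial.X 2) with hS
    set T : MvPolynomial (Fin 3) ℂ := MvPolynomial.X 1 * MvPolynomial.X 1 with hT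
    have hShom : S.IsHomogeneous 2 := (((hX 0).mul (hX 0)).add (hC a ((hX 0).mul (hX 2)))).add
      (hC b ((hX 2).mul (hX 2)))
    have hThom : T.IsHomogeneous 2 := (hX 1).mul (hX 1)
    refine ⟨2, MvPolynomial.C α * T + MvPolynomial.C β * S,
      MvPolynomial.C γ * T + MvPolynomial.C δ * S, (hC α hThom).add (hC β hShom),
      (hC γ hThom).add (hC δ hShom), ?_, ?_⟩
    · rintro ⟨h1, h2⟩
      simp only [map_add, map_mul, MvPolynomial.eval_C] at h1 h2
      have := (hindep h1 h2).1
      simp [hT, coords] at this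
    · rintro (_ | ⟨x, y, hQ⟩) hne
      · simp only [xCoord, toSphere_moebius_infty h]
        simp [hT, hS, coords]
      · simp only [xCoord, toSphere_moebius h]
        have heq := hQ.1
        rw [Affine.equation_iff] at heq
        simp only [modelCurve] at heq
        have hF : ∀ c d : ℂ, MvPolynomial.eval (coords (.some x y hQ))
            (MvPolynomial.C c * T + MvPolynomial.C d * S) =
              (x ^ 2 + a * x + b) * (c * x + d) := fun c d => by
          simp [hT, hS, coords]
          linear_combination c * heq
        rw [hF, hF] at hne ⊢
        rw [ratio_mul_left]
        intro h0
        exact hne (by simp [h0])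
  · refine ⟨1, MvPolynomial.C α * MvPolynomial.X 0 + MvPolynomial.C β * MvPolynomial.X 2,
      MvPolynomial.C γ * MvPolynomial.X 0 + MvPolynomial.C δ * MvPolynomial.X 2,
      (hC α (hX 0)).add (hC β (hX 2)), (hC γ (hX 0)).add (hC δ (hX 2)), ?_, ?_⟩
    · rintro ⟨h1, h2⟩
      simp only [map_add, map_mul, MvPolynomial.eval_C, MvPolynomial.eval_X] at h1 h2
      have := (hindep h1 h2).2
      simp [coords] at this
    · rintro (_ | ⟨x, y, hQ⟩) hne
      · simp [coords] at hne
      · simp only [xCoord, toSphere_moebius h]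
        simp [coords]

/-- Fibres are pairs {P, -P}; the exceptional values come from infinity and from the roots of the
cubic, where P = -P. -/
lemma hasDegree_xCoord {a b : ℂ} (h : Admissible a b) {f g : RatFunc ℂ}
    (hfg : IsInversePair f g) :
    HasDegree (fun P : (modelCurve a b).toAffine.Point => toSphere f (xCoord P)) 2 := by
  have := h.isElliptic
  have hbad := Filter.eventually_cofinite.1
    (eventually_eval_ne_zero (doublingDenom_ne_zero (modelCurve a b)))
  refine Filter.eventually_cofinite.2 (((hbad.image fun x : ℂ => toSphere f x).union
    (Set.finite_singleton (toSphere f OnePoint.infty))).subset fun t ht => ?_)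
  by_contra hcon
  apply ht
  obtain ⟨c, rfl⟩ : ∃ c, toSphere f c = t := ⟨_, hfg.1 t⟩
  induction c using OnePoint.rec with
  | infty => exact absurd (Or.inr rfl) hcon
  | coe c =>
    have hc : (doublingDenom (modelCurve a b)).eval c ≠ 0 :=
      fun h0 => hcon (Or.inl ⟨c, by simpa using h0, rfl⟩)
    obtain ⟨y, hy⟩ := exists_nonsingular (W := modelCurve a b) c
    have hyy := (ne_negY_iff hy.1).2 hc
    rw [Set.ncard_eq_two]
    refine ⟨.some c y hy, -.some c y hy, by simpa using hyy, ?_⟩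
    ext P
    simp only [Set.mem_preimage, Set.mem_singleton_iff, Set.mem_insert_iff]
    constructor
    · intro hP
      have h1 := congrArg (toSphere g) hP
      rw [hfg.2, hfg.2] at h1
      obtain (_ | ⟨x, v, hv⟩) := P
      · exact absurd h1 (OnePoint.infty_ne_coe _)
      · exact Affine.Point.X_eq_iff.1 (OnePoint.coe_eq_coe.1 h1)
    · rintro (rfl | rfl) <;> rfl

lemma xCoord_two_nsmul {a b : ℂ} (h : Admissible a b) (P : (modelCurve a b).toAffine.Point) :
    toSphere (duplication a b) (xCoord P) = xCoord ((2 : ℕ) • P) := by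
  obtain (_ | ⟨x, y, hP⟩) := P
  · have : (2 : ℕ) • (Affine.Point.zero : (modelCurve a b).toAffine.Point) = .zero :=
      nsmul_zero 2
    rw [this]
    exact toSphere_duplication_infty a b
  · by_cases hx : (doublingDenom (modelCurve a b)).eval x = 0
    · have hy : y = (modelCurve a b).toAffine.negY x y := by
        by_contra hy
        exact (ne_negY_iff hP.1).1 hy hx
      rw [two_nsmul, Affine.Point.add_self_of_Y_eq hy]
      change toSphere (duplication a b) x = OnePoint.infty
      rw [h.toSphere_duplication, ratio_eq_infty_iff]
      simpa [doublingDenom_modelCurve] using hx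
    · obtain ⟨y', h', h2⟩ := exists_two_nsmul_eq hP hx
      rw [h2, ← doubling_modelCurve]
      exact toSphere_frac hx

lemma IsConjugate.isLattes {a b : ℂ} (h : Admissible a b) {A : RatFunc ℂ}
    (hA : IsConjugate A (duplication a b)) : IsLattes (jInvariant a b) A := by
  obtain ⟨f, g, hfg, hA⟩ := hA
  have := h.isElliptic
  refine ⟨modelCurve a b, this, fun P => toSphere f (xCoord P), modelCurve_j a b, ?_,
    hasDegree_xCoord h hfg, ?_, fun P => ?_⟩
  · obtain ⟨α, β, γ, δ, hdet, rfl⟩ := hfg.eq_moebius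
    exact isMorphism_moebius_xCoord a b hdet
  · rintro (_ | ⟨x, y, hP⟩) <;> rfl
  · rw [hA, xCoord_two_nsmul h]

/-! ### The parametrization by `β` and the modular polynomial. -/

lemma beta_eq_frac : beta = frac (C 64 * (X + C 4) ^ 3) (X ^ 2) := by
  have h (n : ℕ) : algebraMap ℂ[X] (RatFunc ℂ) (C (n : ℂ)) = n := by simp
  have h64 := h 64
  have h4 := h 4
  push_cast at h64 h4
  rw [beta, frac, map_mul, map_pow, map_pow, map_add, RatFunc.algebraMap_X, h64, h4]

lemma toSphere_beta {z : ℂ} (hz : z ≠ 0) :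
    toSphere beta z = ((64 * (z + 4) ^ 3 / z ^ 2 : ℂ) : OnePoint ℂ) := by
  rw [beta_eq_frac, toSphere_frac (by simpa using hz)]
  simp

lemma toSphere_beta_zero : toSphere beta (0 : ℂ) = OnePoint.infty := by
  rw [beta_eq_frac, toSphere_frac_coe (by simp) (pow_ne_zero _ X_ne_zero), ratio_eq_infty_iff]
  simp

lemma toSphere_beta_infty : toSphere beta OnePoint.infty = OnePoint.infty := by
  rw [beta_eq_frac]
  refine toSphere_frac_infty (pow_ne_zero _ X_ne_zero) ?_
  rw [natDegree_C_mul (by norm_num)]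
  simp only [natDegree_pow, natDegree_X_add_C, natDegree_X]
  norm_num

lemma toSphere_inv {z : ℂ} (hz : z ≠ 0) :
    toSphere (1 / RatFunc.X) z = ((1 / z : ℂ) : OnePoint ℂ) := by
  have : (1 / RatFunc.X : RatFunc ℂ) = frac 1 X := by simp [frac]
  rw [this, toSphere_frac (by simpa using hz)]
  simp

lemma kleinCorrespondence_iff {x y : ℂ} : kleinCorrespondence x y ↔ ∃ z : ℂ, z ≠ 0 ∧
    64 * (z + 4) ^ 3 / z ^ 2 = x ∧ 64 * (1 / z + 4) ^ 3 / (1 / z) ^ 2 = y := by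
  constructor
  · rintro ⟨z, h1, h2⟩
    induction z using OnePoint.rec with
    | infty =>
      rw [toSphere_beta_infty] at h1
      exact absurd h1 (OnePoint.infty_ne_coe _)
    | coe z =>
      have hz : z ≠ 0 := by
        rintro rfl
        rw [toSphere_beta_zero] at h1
        exact absurd h1 (OnePoint.infty_ne_coe _)
      rw [toSphere_beta hz, OnePoint.coe_eq_coe] at h1
      rw [toSphere_inv hz, toSphere_beta (one_div_ne_zero hz), OnePoint.coe_eq_coe] at h2
      exact ⟨z, hz, h1, h2⟩
  · rintro ⟨z, hz, h1, h2⟩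
    refine ⟨z, ?_, ?_⟩
    · rw [toSphere_beta hz, h1]
    · rw [toSphere_inv hz, toSphere_beta (one_div_ne_zero hz), h2]

lemma kleinCorrespondence_symm {x y : ℂ} (h : kleinCorrespondence x y) :
    kleinCorrespondence y x := by
  obtain ⟨z, hz, h1, h2⟩ := kleinCorrespondence_iff.1 h
  exact kleinCorrespondence_iff.2 ⟨1 / z, one_div_ne_zero hz, h2, by rw [one_div_one_div]; exact h1⟩

/-- The parameter is z = 4d / (c² - 4d); passing to the isogenous curve replaces it by its inverse.
-/
lemma Admissible.kleinCorrespondence {c d : ℂ} (h : Admissible c d) :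
    kleinCorrespondence (jInvariant c d) (jInvariant (-2 * c) (c ^ 2 - 4 * d)) := by
  have hd := h.left
  have hδ := h.right
  refine kleinCorrespondence_iff.2 ⟨4 * d / (c ^ 2 - 4 * d),
    div_ne_zero (mul_ne_zero (by norm_num) hd) hδ, ?_, ?_⟩
  · unfold jInvariant
    have h1 : 4 * d / (c ^ 2 - 4 * d) + 4 = 4 * (c ^ 2 - 3 * d) / (c ^ 2 - 4 * d) := by
      field_simp; ring
    rw [h1]
    field_simp
    ring
  · unfold jInvariant
    have h1 : 1 / (4 * d / (c ^ 2 - 4 * d)) + 4 = (c ^ 2 + 12 * d) / (4 * d) := by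
      field_simp; ring
    have h2 : (-2 * c) ^ 2 - 3 * (c ^ 2 - 4 * d) = c ^ 2 + 12 * d := by ring
    have h3 : (-2 * c) ^ 2 - 4 * (c ^ 2 - 4 * d) = 16 * d := by ring
    rw [h1, h2, h3]
    field_simp
    ring

/-- The choice d = z, c² = 4z + 4 normalizes c² - 4d to 4, so that the parameter 4d / (c² - 4d) is
`z`. -/
lemma exists_admissible_of_kleinCorrespondence {x y : ℂ}
    (h : Recomposition.kleinCorrespondence x y) : ∃ c d, Admissible c d ∧ jInvariant c d = x ∧
      jInvariant (-2 * c) (c ^ 2 - 4 * d) = y := by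
  obtain ⟨z, hz, rfl, rfl⟩ := kleinCorrespondence_iff.1 h
  obtain ⟨c, hc⟩ := IsAlgClosed.exists_pow_nat_eq (4 * z + 4) (n := 2) (by norm_num)
  have hδ : c ^ 2 - 4 * z = 4 := by rw [hc]; ring
  refine ⟨c, z, ?_, ?_, ?_⟩
  · unfold Admissible
    rw [hδ]
    exact mul_ne_zero (pow_ne_zero _ hz) (by norm_num)
  · unfold jInvariant
    rw [hδ, hc]
    field_simp
    ring
  · unfold jInvariant
    have h2 : (-2 * c) ^ 2 = 16 * z + 16 := by linear_combination 4 * hc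
    have h3 : 16 * z + 16 - 4 * 4 = 16 * z := by ring
    rw [hδ, h2, h3]
    field_simp
    ring

/-- It suffices to solve β(z) = j: the cubic is 64 (z + 4)³ - j z², whose constant term keeps its
roots away from 0. -/
lemma exists_jInvariant_eq (j : ℂ) : ∃ a b, Admissible a b ∧ jInvariant a b = j := by
  obtain ⟨z, hz⟩ := IsAlgClosed.exists_root
    (C 64 * X ^ 3 + C (768 - j) * X ^ 2 + C 3072 * X + C 4096 : ℂ[X])
    (by rw [degree_cubic (by norm_num)]; norm_num)
  have hz' : 64 * z ^ 3 + (768 - j) * z ^ 2 + 3072 * z + 4096 = 0 := by simpa using hz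
  have hz0 : z ≠ 0 := by
    rintro rfl
    norm_num at hz'
  obtain ⟨a, b, h, hj, -⟩ := exists_admissible_of_kleinCorrespondence
    (kleinCorrespondence_iff.2 ⟨z, hz0, rfl, rfl⟩)
  refine ⟨a, b, h, hj.trans ?_⟩
  rw [div_eq_iff (pow_ne_zero _ hz0)]
  linear_combination hz'

lemma curveCorrespondence_Phi2_iff {x y : ℂ} : curveCorrespondence Phi2 x y ↔
    x ^ 3 + y ^ 3 - x ^ 2 * y ^ 2 + 2 ^ 4 * 3 * 31 * (x * y * (x + y))
      + 3 ^ 4 * 5 ^ 3 * 4027 * (x * y) - 2 ^ 4 * 3 ^ 4 * 5 ^ 3 * (x ^ 2 + y ^ 2)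
      + 2 ^ 8 * 3 ^ 7 * 5 ^ 6 * (x + y) - 2 ^ 12 * 3 ^ 9 * 5 ^ 9 = 0 := by
  simp [curveCorrespondence, Phi2]

/-- The modular polynomial of level two, factored over the roots of `β(z) = x`. -/
lemma Phi2_eq_prod {a b c x y : ℂ} (h2 : a * b + b * c + c * a = 48) (h3 : a * b * c = -64)
    (hx : x = 64 * (a + b + c + 12)) :
    x ^ 3 + y ^ 3 - x ^ 2 * y ^ 2 + 2 ^ 4 * 3 * 31 * (x * y * (x + y))
      + 3 ^ 4 * 5 ^ 3 * 4027 * (x * y) - 2 ^ 4 * 3 ^ 4 * 5 ^ 3 * (x ^ 2 + y ^ 2)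
      + 2 ^ 8 * 3 ^ 7 * 5 ^ 6 * (x + y) - 2 ^ 12 * 3 ^ 9 * 5 ^ 9 =
    (y - (768 - b * c + 3072 * a + 4096 * a ^ 2)) * (y - (768 - c * a + 3072 * b + 4096 * b ^ 2)) *
      (y - (768 - a * b + 3072 * c + 4096 * c ^ 2)) := by
  -- The hypotheses are Vieta's formulas for the roots of 64 (z + 4)³ = x z². Since 64 / a = -bc,
  -- the first factor vanishes exactly at y = β(1/a), and the other two likewise.
  grind

lemma klein_relation {a b c : ℂ} (h2 : a * b + b * c + c * a = 48) (h3 : a * b * c = -64)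
    {x y : ℂ} (hx : x = 64 * (a + b + c + 12))
    (hy : y = 768 - b * c + 3072 * a + 4096 * a ^ 2) : kleinCorrespondence x y := by
  have ha : a ≠ 0 := by
    rintro rfl
    norm_num at h3
  refine kleinCorrespondence_iff.2 ⟨a, ha, ?_, ?_⟩
  · rw [div_eq_iff (pow_ne_zero _ ha), hx]
    linear_combination -64 * a * h2 + 64 * h3
  · rw [hy]
    field_simp
    linear_combination h3

/-- By Vieta the other two roots have product -64 / z and sum (48 + 64 / z) / z, so they solve a
quadratic equation. -/
lemma exists_sum_roots {z x : ℂ} (hz : z ≠ 0) (hx : 64 * (z + 4) ^ 3 / z ^ 2 = x) :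
    ∃ b c, z * b + b * c + c * z = 48 ∧ z * b * c = -64 ∧ x = 64 * (z + b + c + 12) := by
  obtain ⟨b, hb⟩ := exists_quadratic_root (-((48 + 64 / z) / z)) (-64 / z)
  refine ⟨b, (48 + 64 / z) / z - b, ?_, ?_, ?_⟩
  · have : b * ((48 + 64 / z) / z - b) = -64 / z := by linear_combination -hb
    have h2 : z * ((48 + 64 / z) / z) = 48 + 64 / z := by field_simp
    linear_combination this + h2
  · have : b * ((48 + 64 / z) / z - b) = -64 / z := by linear_combination -hb
    rw [mul_assoc, this]
    field_simp
  · rw [← hx]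
    field_simp
    ring

/-- The correspondence given by the modular polynomial of level two is the multivalued function
`β ∘ (1/z) ∘ β⁻¹`. -/
lemma curveCorrespondence_Phi2_eq : curveCorrespondence Phi2 = kleinCorrespondence := by
  funext x y
  refine propext ?_
  rw [curveCorrespondence_Phi2_iff]
  constructor
  · intro h
    -- A model with j-invariant `x` supplies one root of β(z) = x; the vanishing factor of Φ₂ then
    -- selects which of the three roots relates `x` to `y`.
    obtain ⟨u, v, huv, rfl⟩ := exists_jInvariant_eq x
    obtain ⟨z, hz, hx, -⟩ := kleinCorrespondence_iff.1 huv.kleinCorrespondence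
    obtain ⟨b, c, h2, h3, hx'⟩ := exists_sum_roots hz hx
    rw [Phi2_eq_prod h2 h3 hx'] at h
    rcases mul_eq_zero.1 h with h | h
    · rcases mul_eq_zero.1 h with h | h
      · exact klein_relation h2 h3 hx' (sub_eq_zero.1 h)
      · exact klein_relation (a := b) (b := c) (c := z) (by linear_combination h2)
          (by linear_combination h3) (by rw [hx']; ring) (by linear_combination h)
    · exact klein_relation (a := c) (b := z) (c := b) (by linear_combination h2)
          (by linear_combination h3) (by rw [hx']; ring) (by linear_combination h)
  · intro h
    obtain ⟨z, hz, hx, hy⟩ := kleinCorrespondence_iff.1 h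
    obtain ⟨b, c, h2, h3, hx'⟩ := exists_sum_roots hz hx
    rw [Phi2_eq_prod h2 h3 hx']
    have hbc : b * c = -64 / z := by
      rw [eq_div_iff hz]; linear_combination h3
    have : y = 768 - b * c + 3072 * z + 4096 * z ^ 2 := by
      rw [hbc, ← hy]
      field_simp
      ring
    rw [this, sub_self, zero_mul, zero_mul]

/-! ### Equivalence classes as orbits. -/

lemma isOrbit_of_symm {R : ℂ → ℂ → Prop} (hR : ∀ {x y}, R x y → R y x) (x : ℂ) :
    IsOrbit R x (forwardOrbit R x) := by
  have hrev : ∀ {x y}, Relation.ReflTransGen R x y → Relation.ReflTransGen R y x := by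
    intro x y h
    induction h with
    | refl => exact .refl
    | tail _ h ih => exact ih.head (hR h)
  refine ⟨rfl, ?_, ?_⟩
  · ext y
    exact ⟨hrev, hrev⟩
  · ext y
    exact ⟨Relation.ReflTransGen.mono (p := fun a b => R a b ∨ R b a)
        (fun _ _ => Or.inl) x y,
      Relation.ReflTransGen.mono (r := fun a b => R a b ∨ R b a) (p := R)
        (fun _ _ h => Or.elim h id hR) x y⟩

lemma IsLattes.unique {j j' : ℂ} {A : RatFunc ℂ} (h : IsLattes j A) (h' : IsLattes j' A) :
    j = j' := by
  obtain ⟨a, b, hab, rfl⟩ := exists_jInvariant_eq j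
  obtain ⟨a', b', hab', rfl⟩ := exists_jInvariant_eq j'
  exact hab.jInvariant_eq hab' ((h.isConjugate hab).symm.trans (h'.isConjugate hab'))

lemma IsLattes.equivalent {j : ℂ} {A B : RatFunc ℂ} (hA : IsLattes j A) (hB : IsLattes j B) :
    Equivalent A B := by
  obtain ⟨a, b, hab, rfl⟩ := exists_jInvariant_eq j
  have hc := duplication_not_isConst a b
  exact .tail (.single ((hA.isConjugate hab).isElementaryTransformation hc))
    ((hB.isConjugate hab).isElementaryTransformation hc).symm

lemma IsLattes.exists_of_equivalent {j : ℂ} {A B : RatFunc ℂ} (hA : IsLattes j A)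
    (h : Equivalent A B) :
    ∃ j', IsLattes j' B ∧ Relation.ReflTransGen kleinCorrespondence j j' := by
  induction h with
  | refl => exact ⟨j, hA, .refl⟩
  | tail _ hstep ih =>
    obtain ⟨j₁, hB, hj⟩ := ih
    obtain ⟨a, b, hab, rfl⟩ := exists_jInvariant_eq j₁
    obtain ⟨c, d, hcd, hcdj, hD⟩ :=
      hab.isConjugate_of_isElementaryTransformation (hB.isConjugate hab) hstep
    -- The pair (c, d) is a model with the same j-invariant, so only a passage to its isogenous
    -- curve costs a step of the correspondence.
    rw [← hcdj] at hj
    rcases hD with hD | hD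
    · exact ⟨_, hD.isLattes hcd, hj⟩
    · exact ⟨_, hD.isLattes hcd.dual, hj.tail hcd.kleinCorrespondence⟩

lemma IsLattes.equivalent_of_reflTransGen {j j' : ℂ} {A : RatFunc ℂ} (hA : IsLattes j A)
    (h : Relation.ReflTransGen kleinCorrespondence j j') :
    ∀ B, IsLattes j' B → Equivalent B A := by
  induction h with
  | refl => exact fun B hB => hB.equivalent hA
  | tail _ hstep ih =>
    intro B hB
    obtain ⟨c, d, hcd, rfl, rfl⟩ := exists_admissible_of_kleinCorrespondence hstep
    have h1 := ih _ ((IsConjugate.refl (duplication c d)).isLattes hcd)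
    have h2 := hB.equivalent ((IsConjugate.refl _).isLattes hcd.dual)
    exact h2.trans (h1.head (duplication_isElementaryTransformation_dual c d).symm)

end Recomposition

theorem theorem2 (j : ℂ) :
    (∃ A : RatFunc ℂ, IsLattes j A) ∧
    ∀ A : RatFunc ℂ, IsLattes j A →
      (∀ B : RatFunc ℂ, Equivalent B A → ∃ j' : ℂ, IsLattes j' B) ∧
      {j' : ℂ | ∃ B : RatFunc ℂ, IsLattes j' B ∧ Equivalent B A} =
        {j' : ℂ | ∀ B : RatFunc ℂ, IsLattes j' B → Equivalent B A} ∧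
      IsOrbit (curveCorrespondence Phi2) j
        {j' : ℂ | ∃ B : RatFunc ℂ, IsLattes j' B ∧ Equivalent B A} ∧
      IsOrbit kleinCorrespondence j
        {j' : ℂ | ∃ B : RatFunc ℂ, IsLattes j' B ∧ Equivalent B A} := by
  have hex : ∀ j, ∃ A : RatFunc ℂ, IsLattes j A := fun j => by
    obtain ⟨a, b, hab, rfl⟩ := exists_jInvariant_eq j
    exact ⟨_, (IsConjugate.refl _).isLattes hab⟩
  refine ⟨hex j, fun A hA => ?_⟩
  have horbit : {j' : ℂ | ∃ B : RatFunc ℂ, IsLattes j' B ∧ Equivalent B A} =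
      forwardOrbit kleinCorrespondence j := by
    ext j'
    constructor
    · rintro ⟨B, hB, hBA⟩
      obtain ⟨j'', hB', hj⟩ := hA.exists_of_equivalent hBA.symm
      -- The chain yields some j-invariant for `B`; uniqueness identifies it with the given one.
      rwa [hB.unique hB']
    · intro h
      obtain ⟨B, hB⟩ := hex j'
      exact ⟨B, hB, hA.equivalent_of_reflTransGen h B hB⟩
  refine ⟨fun B hB => ?_, ?_, ?_, ?_⟩
  · obtain ⟨j', h, -⟩ := hA.exists_of_equivalent hB.symm
    exact ⟨j', h⟩
  · ext j'
    constructor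
    · rintro ⟨B, hB, hBA⟩ D hD
      exact (hD.equivalent hB).trans hBA
    · intro h
      obtain ⟨B, hB⟩ := hex j'
      exact ⟨B, hB, h B hB⟩
  · rw [curveCorrespondence_Phi2_eq, horbit]
    exact isOrbit_of_symm kleinCorrespondence_symm j
  · rw [horbit]
    exact isOrbit_of_symm kleinCorrespondence_symm j
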